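/- Let $d\ge 1$ and let $X_1,\ldots,X_{d+2}$ be i.i.d. random points in $\mathbb{R}^d$ with the standard normal distribution. For a polyhedral cone $C$ in a Euclidean space with closed unit ball $B$, let $$\alpha(C)=\frac{\lambda_{\mathrm{lin}\,C}(B\cap C)}{\lambda_{\mathrm{lin}\,C}(B\cap \mathrm{lin}\,C)}$$ be its solid angle, where $\mathrm{lin}\,C$ is the linear hull of $C$ and $\lambda_{\mathrm{lin}\,C}$ is the Lebesgue measure on it. Let $e_1,\ldots,e_n$ be the standard orthonormal basis of $\mathbb{R}^n$, and let $$\mathbb{J}_{n,1}(\infty)=\sum_{i=1}^n \alpha\Big(\Big\{\sum_{j\ne i}\lambda_j (e_j-e_i):\ \lambda_j\ge 0\Big\}\Big)$$ be the sum of the internal solid angles at the vertices of the regular $(n-1)$-dimensional simplex with vertices $e_1,\ldots,e_n$. Let $$\Phi(z)=\frac12+\frac1{\sqrt{2\pi}}\int_0^z e^{-t^2/2}\,dt,\qquad z\in\mathbb{C},$$ be the entire extension of the standard normal distribution function. Then the probability that the convex hull of $X_1,\ldots,X_{d+2}$ is a simplex is $$\mathbb{P}\big[\mathrm{conv}(X_1,\ldots,X_{d+2})\text{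 is a simplex}\big]=2\,\mathbb{J}_{d+2,1}(\infty)=\frac{2(d+2)}{\sqrt{2\pi}}\int_{-\infty}^{+\infty}\Phi^{d+1}\Big(\frac{ix}{\sqrt{d+2}}\Big)e^{-x^2/2}\,dx,$$ where the last integral converges absolutely. -/

import Mathlib

open MeasureTheory ProbabilityTheory Set

/-- The positive hull `{λ₁ x₁ + ... + λₙ xₙ : λ₁, ..., λₙ ≥ 0}` of a finite family of vectors. -/
def posHull {ι E : Type*} [Fintype ι] [AddCommGroup E] [Module ℝ E] (x : ι → E) : Set E :=
  {y | ∃ c : ι → ℝ, (∀ i, 0 ≤ c i) ∧ y = ∑ i, c i • x i}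

/-- The solid angle of a cone `C`: the proportion of the unit ball of the linear hull of `C`
which is occupied by `C`, where `volume` is Lebesgue measure on the linear hull
(as a Euclidean space in its own right). -/
noncomputable def solidAngle {E : Type*} [NormedAddCommGroup E] [InnerProductSpace ℝ E]
    [FiniteDimensional ℝ E] [MeasurableSpace E] [BorelSpace E] (C : Set E) : ℝ :=
  (volume : Measure (Submodule.span ℝ C)).real {v | (v : E) ∈ Metric.closedBall 0 1 ∩ C} /
    (volume : Measure (Submodule.span ℝ C)).real {v | (v : E) ∈ Metric.closedBall 0 1}

/-- The internal angle at the vertex `x i` of the simplex with vertices `x j`. -/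
noncomputable def internalAngle {ι E : Type*} [Fintype ι] [DecidableEq ι]
    [NormedAddCommGroup E] [InnerProductSpace ℝ E]
    [FiniteDimensional ℝ E] [MeasurableSpace E] [BorelSpace E] (x : ι → E) (i : ι) : ℝ :=
  solidAngle (posHull fun j : {j : ι // j ≠ i} => x j - x i)

/-- The sum of the internal angles at the vertices of the regular simplex `[e₁, ..., eₙ]`
of dimension `n - 1`, spanned by the standard orthonormal basis of `ℝⁿ`. -/
noncomputable def regularSimplexAngleSum (n : ℕ) : ℝ :=
  ∑ i : Fin n, internalAngle
    (fun j : Fin n => (EuclideanSpace.single j (1 : ℝ) : EuclideanSpace ℝ (Fin n))) i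

/-- A set is a simplex if it is the convex hull of a finite nonempty affinely independent
family of points. -/
def IsSimplex {E : Type*} [AddCommGroup E] [Module ℝ E] (S : Set E) : Prop :=
  ∃ (k : ℕ) (v : Fin (k + 1) → E), AffineIndependent ℝ v ∧ S = convexHull ℝ (range v)

/-- The entire extension of the standard normal distribution function,
`Φ(z) = 1/2 + (1/√(2π)) ∫₀ᶻ exp(-t²/2) dt`, the integral being taken along the segment
`t = s z`, `0 ≤ s ≤ 1`. -/
noncomputable def complexPhi (z : ℂ) : ℂ :=
  1 / 2 + 1 / (√(2 * Real.pi) : ℂ) * ∫ s : ℝ in (0 : ℝ)..1, Complex.exp (-((s : ℂ) * z) ^ 2 / 2) * z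

/-- `complexPhi` is an entire function. -/
theorem complexPhi_differentiable : Differentiable ℂ complexPhi := by
  have hf : Differentiable ℂ fun z : ℂ => Complex.exp (-z ^ 2 / 2) := by fun_prop
  obtain ⟨g, hg⟩ := hf.isExactOn_univ
  have hg' : ∀ z : ℂ, HasDerivAt g (Complex.exp (-z ^ 2 / 2)) z := fun z => hg z (mem_univ z)
  have key : complexPhi = fun z => 1 / 2 + 1 / (√(2 * Real.pi) : ℂ) * (g z - g 0) := by
    funext z
    have h : ∀ s ∈ uIcc (0 : ℝ) 1, HasDerivAt (fun s : ℝ => g (s * z))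
        (Complex.exp (-((s : ℂ) * z) ^ 2 / 2) * z) s := by
      intro s _
      have h1 : HasDerivAt (fun w : ℂ => w * z) z (s : ℂ) := by
        simpa using (hasDerivAt_id (s : ℂ)).mul_const z
      exact ((hg' _).comp (s : ℂ) h1).comp_ofReal
    have := intervalIntegral.integral_eq_sub_of_hasDerivAt h
      (Continuous.intervalIntegrable (by fun_prop) _ _)
    simp [complexPhi, this]
  rw [key]
  have : Differentiable ℂ g := fun z => (hg' z).differentiableAt
  fun_prop

/-- On the real line `complexPhi` is the standard normal distribution function. -/
theorem complexPhi_ofReal (x : ℝ) : complexPhi x = (cdf (gaussianReal 0 1) x : ℂ) := by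
  have hc : gaussianPDFReal 0 1 = fun t : ℝ => 1 / √(2 * Real.pi) * Real.exp (-t ^ 2 / 2) := by
    funext t; simp [gaussianPDFReal]
  have hint := integrable_gaussianPDFReal 0 1
  have h0 : ∫ t in Iic (0 : ℝ), gaussianPDFReal 0 1 t = 1 / 2 := by
    have h1 : ∫ t in Iic (0 : ℝ), gaussianPDFReal 0 1 t =
        ∫ t in Ioi (0 : ℝ), gaussianPDFReal 0 1 t := by
      have := integral_comp_neg_Iic (0 : ℝ) (gaussianPDFReal 0 1)
      simpa [gaussianPDFReal] using this
    have h2 := intervalIntegral.integral_Iic_add_Ioi (b := (0 : ℝ)) hint.integrableOn hint.integrableOn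
    rw [integral_gaussianPDFReal_eq_one 0 one_ne_zero, ← h1] at h2
    linarith
  have h3 := intervalIntegral.integral_Iic_sub_Iic (a := 0) (b := x) hint.integrableOn
    hint.integrableOn
  have h4 : cdf (gaussianReal 0 1) x = 1 / 2 + ∫ t in (0 : ℝ)..x, gaussianPDFReal 0 1 t := by
    rw [cdf_eq_real, measureReal_def, gaussianReal_apply_eq_integral 0 one_ne_zero,
      ENNReal.toReal_ofReal (integral_nonneg (gaussianPDFReal_nonneg _ _))]
    linarith
  have h5 : ∫ t in (0 : ℝ)..x, gaussianPDFReal 0 1 t =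
      1 / √(2 * Real.pi) * ∫ s in (0 : ℝ)..1, Real.exp (-(s * x) ^ 2 / 2) * x := by
    rw [hc, intervalIntegral.integral_const_mul, intervalIntegral.integral_mul_const, mul_comm _ x,
      intervalIntegral.mul_integral_comp_mul_right (f := fun t => Real.exp (-t ^ 2 / 2))]
    simp
  rw [h4, h5, complexPhi]
  push_cast [← intervalIntegral.integral_ofReal]
  rfl

/-! Almost surely the `d + 2` points have, up to scale, exactly one affine dependence, and all its
coefficients are nonzero. Their hull is a simplex iff one point lies in the hull of the others, i.e.
iff some coefficient has the sign opposite to all the rest (`isSimplex_convexHull_iff`). So plus or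
minus the dependence lies in a tangent cone at a vertex of the regular simplex.

The dependence is taken as the vector of signed maximal minors. A reflection of the hyperplane of
sum-zero vectors extends to an orthogonal matrix fixing the all-ones vector. Mixing the Gaussian
points by this matrix preserves their law and, up to sign, reflects the dependence
(`reflectionInvariant_dependenceLaw`). A reflection invariant law gives each cone its solid angle
(`ReflectionInvariant.solidAngle_eq`). The `2 (d + 2)` cones are almost surely disjoint, whence
twice the angle sum.

For the integral, the angle is computed with the standard Gaussian of the hyperplane. In the
coordinates `c j`, `j ≠ i`, the squared norm is `∑ c j ^ 2 + (∑ c j) ^ 2` and the cone is the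
orthant. Writing `exp (-(∑ c j) ^ 2 / 2)` as a Gaussian average of `exp (I x ∑ c j)` factorises the
integral into half-line characteristic functions `exp (-x ^ 2 / 2) Φ(I x)`, and a rescaling of `x`
gives the formula. -/

/-! ### Reflection invariant measures and cones -/

section ReflectionInvariant

open scoped RealInnerProductSpace

variable {E : Type*} [NormedAddCommGroup E] [InnerProductSpace ℝ E]

/-- The radial projection to the unit sphere. -/
noncomputable def radialProj (x : E) : E := ‖x‖⁻¹ • x

theorem norm_radialProj {x : E} (hx : x ≠ 0) : ‖radialProj x‖ = 1 := by
  rw [radialProj, norm_smul, norm_inv, norm_norm, inv_mul_cancel₀ (norm_ne_zero_iff.2 hx)]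

variable [FiniteDimensional ℝ E] [MeasurableSpace E] [BorelSpace E]

/-- A measure is reflection invariant if it is preserved by all reflections in hyperplanes. -/
def ReflectionInvariant (μ : Measure E) : Prop :=
  ∀ w : E, μ.map (Submodule.reflection (ℝ ∙ w)ᗮ) = μ

theorem measurable_radialProj : Measurable (radialProj : E → E) := by
  unfold radialProj; fun_prop

theorem ReflectionInvariant.map_radialProj {μ : Measure E} (h : ReflectionInvariant μ) :
    ReflectionInvariant (μ.map radialProj) := by
  intro w
  have hm : Measurable (Submodule.reflection (ℝ ∙ w)ᗮ) :=
    (Submodule.reflection (ℝ ∙ w)ᗮ).continuous.measurable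
  rw [Measure.map_map hm measurable_radialProj]
  conv_rhs => rw [← h w]
  rw [Measure.map_map measurable_radialProj hm]
  congr 1
  ext x
  simp [radialProj]

theorem ReflectionInvariant.charFun_eq {μ : Measure E} (h : ReflectionInvariant μ) {s t : E}
    (hst : ‖s‖ = ‖t‖) : charFun μ s = charFun μ t := by
  set ρ := Submodule.reflection (ℝ ∙ (s - t))ᗮ
  have hρ : ρ s = t := Submodule.reflection_sub hst
  have hm : Measurable ρ := ρ.continuous.measurable
  conv_rhs => rw [← h (s - t)]
  rw [charFun_apply, charFun_apply, integral_map hm.aemeasurable (by fun_prop)]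
  congr 1
  ext x
  rw [← hρ]
  simp only [ρ, LinearIsometryEquiv.inner_map_map]

/-- Integrate `exp (I ‖t‖ ⟪x, w⟫)` over both unit vectors. Each characteristic function depends only
on the norm of its argument, so the two orders of integration give the two sides. -/
theorem ReflectionInvariant.charFun_mul_eq {μ ν : Measure E} [IsFiniteMeasure μ]
    [IsFiniteMeasure ν] (hμ : ReflectionInvariant μ) (hν : ReflectionInvariant ν)
    (hμ1 : ∀ᵐ x ∂μ, ‖x‖ = 1) (hν1 : ∀ᵐ x ∂ν, ‖x‖ = 1) (t : E) :
    charFun μ t * ν.real univ = charFun ν t * μ.real univ := by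
  have h1 : ∫ w, charFun μ (‖t‖ • w) ∂ν = charFun μ t * ν.real univ := by
    rw [integral_congr_ae (g := fun _ => charFun μ t)]
    · simp [mul_comm]
    · filter_upwards [hν1] with w hw
      exact hμ.charFun_eq (by simp [norm_smul, hw])
  have h2 : ∫ w, charFun ν (‖t‖ • w) ∂μ = charFun ν t * μ.real univ := by
    rw [integral_congr_ae (g := fun _ => charFun ν t)]
    · simp [mul_comm]
    · filter_upwards [hμ1] with w hw
      exact hν.charFun_eq (by simp [norm_smul, hw])
  rw [← h1, ← h2]
  simp only [charFun_apply]
  rw [integral_integral_swap]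
  · simp only [real_inner_smul_right, real_inner_comm]
  · refine Integrable.of_bound (C := 1) ?_ (ae_of_all _ fun p => ?_)
    · exact Continuous.aestronglyMeasurable (by fun_prop)
    · simp only [Function.uncurry]
      rw [Complex.norm_exp_ofReal_mul_I]

/-- Two reflection invariant finite measures without atom at the origin agree, after
normalisation, on all measurable cones. -/
theorem ReflectionInvariant.real_cone_eq {μ ν : Measure E} [IsFiniteMeasure μ]
    [IsFiniteMeasure ν] (hμ : ReflectionInvariant μ) (hν : ReflectionInvariant ν)
    (hμ0 : μ {0} = 0) (hν0 : ν {0} = 0) {C : Set E} (hC : MeasurableSet C)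
    (hcone : ∀ x : E, ∀ r : ℝ, 0 < r → (r • x ∈ C ↔ x ∈ C)) :
    μ.real C * ν.real univ = ν.real C * μ.real univ := by
  have one : ∀ {κ : Measure E}, κ {0} = 0 → ∀ᵐ x ∂(κ.map radialProj), ‖x‖ = 1 := by
    intro κ h0
    rw [ae_map_iff measurable_radialProj.aemeasurable (measurableSet_eq_fun (by fun_prop) (by fun_prop))]
    filter_upwards [compl_mem_ae_iff.2 h0] with x hx
    exact norm_radialProj hx
  have cone : ∀ {κ : Measure E}, κ {0} = 0 → (κ.map radialProj).real C = κ.real C := by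
    intro κ h0
    rw [map_measureReal_apply measurable_radialProj hC]
    refine measureReal_congr ?_
    filter_upwards [compl_mem_ae_iff.2 h0] with x hx
    exact propext (hcone x _ (inv_pos.2 (norm_pos_iff.2 hx)))
  have tot : ∀ κ : Measure E, (κ.map radialProj).real univ = κ.real univ := by
    intro κ
    rw [map_measureReal_apply measurable_radialProj .univ, preimage_univ]
  set μ' := μ.map radialProj
  set ν' := ν.map radialProj
  -- On the sphere the characteristic functions are proportional, hence so are the measures; neither
  -- the full orthogonal group nor the uniform measure is needed.
  have key : (ν'.real univ).toNNReal • μ' = (μ'.real univ).toNNReal • ν' := by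
    refine Measure.ext_of_charFun (funext fun t => ?_)
    have := ReflectionInvariant.charFun_mul_eq hμ.map_radialProj hν.map_radialProj (one hμ0) (one hν0) t
    simp only [charFun_apply, integral_smul_nnreal_measure] at this ⊢
    simp only [NNReal.smul_def, Real.coe_toNNReal _ measureReal_nonneg, Complex.real_smul]
    rw [mul_comm, this, mul_comm]
  have := congrArg (fun κ : Measure E => κ.real C) key
  simp only [measureReal_nnreal_smul_apply, Real.coe_toNNReal _ measureReal_nonneg] at this
  rw [cone hμ0, cone hν0, show ν'.real univ = _ from tot ν, show μ'.real univ = _ from tot μ]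
    at this
  linarith

end ReflectionInvariant

/-! ### General position and orthogonal mixing of Gaussian points -/

section GaussianFamily

open scoped RealInnerProductSpace

variable {E : Type*} [NormedAddCommGroup E] [InnerProductSpace ℝ E]
  [FiniteDimensional ℝ E] [MeasurableSpace E] [BorelSpace E]

/-- A nonzero `v` orthogonal to the direction is constant on `S`, while `⟪v, ·⟫` has a nondegenerate
Gaussian law on the line. -/
theorem stdGaussian_affineSubspace_eq_zero (S : AffineSubspace ℝ E) (hS : S ≠ ⊤) :
    stdGaussian E (S : Set E) = 0 := by
  rcases S.eq_bot_or_nonempty with rfl | ⟨p, hp⟩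
  · simp
  have hd : S.directionᗮ ≠ ⊥ := by
    intro h
    rw [Submodule.orthogonal_eq_bot_iff] at h
    exact hS ((AffineSubspace.direction_eq_top_iff_of_nonempty ⟨p, hp⟩).1 h)
  obtain ⟨v, hv, hv0⟩ := Submodule.exists_mem_ne_zero_of_ne_bot hd
  have hsub : (S : Set E) ⊆ (innerSL ℝ v) ⁻¹' {⟪v, p⟫} := by
    intro x hx
    have := Submodule.inner_left_of_mem_orthogonal (AffineSubspace.vsub_mem_direction hx hp) hv
    rw [vsub_eq_sub, inner_sub_right] at this
    simpa [sub_eq_zero] using this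
  refine measure_mono_null hsub ?_
  rw [← Measure.map_apply (by fun_prop) (measurableSet_singleton _), IsGaussian.map_eq_gaussianReal]
  have : NullSingletonClass (gaussianReal ((stdGaussian E)[innerSL ℝ v])
      (Var[innerSL ℝ v; stdGaussian E]).toNNReal) := by
    refine nullSingletonClass_gaussianReal ?_
    rw [variance_dual_stdGaussian]
    simpa using hv0
  exact measure_singleton _

theorem measurableSet_affineIndependent {ι : Type*} [Finite ι] :
    MeasurableSet {x : ι → E | AffineIndependent ℝ x} := by
  have : Fintype ι := Fintype.ofFinite ι
  exact isOpen_setOfPred_affineIndependent.measurableSet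

theorem ae_affineIndependent_pi_stdGaussian (k : ℕ) (hk : k ≤ Module.finrank ℝ E + 1) :
    ∀ᵐ x ∂Measure.pi fun _ : Fin k => stdGaussian E, AffineIndependent ℝ x := by
  induction k with
  | zero => exact ae_of_all _ fun x => affineIndependent_of_subsingleton ℝ x
  | succ k ih =>
    have mp := (measurePreserving_piFinSuccAbove (fun _ : Fin (k + 1) => stdGaussian E) 0).symm
    have hms := mp.measurable (measurableSet_affineIndependent (E := E) (ι := Fin (k + 1)))
    rw [← mp.map_eq, ae_map_iff mp.measurable.aemeasurable measurableSet_affineIndependent,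
      Measure.ae_prod_iff_ae_ae (p := fun z => AffineIndependent ℝ
        ((MeasurableEquiv.piFinSuccAbove (fun _ : Fin (k + 1) => E) 0).symm z)) hms,
      Measure.ae_ae_comm (p := fun a y => AffineIndependent ℝ
        ((MeasurableEquiv.piFinSuccAbove (fun _ : Fin (k + 1) => E) 0).symm (a, y))) hms]
    filter_upwards [ih (by omega)] with y hy
    -- The `k` earlier points are too few to span, so the fresh point almost surely avoids their
    -- affine span.
    have hne : affineSpan ℝ (range y) ≠ ⊤ := by
      intro h
      have := hy.affineSpan_eq_top_iff_card_eq_finrank_add_one.1 h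
      simp at this
      omega
    filter_upwards [compl_mem_ae_iff.2 (stdGaussian_affineSubspace_eq_zero _ hne)] with a ha
    change AffineIndependent ℝ (Fin.insertNth 0 a y : Fin (k + 1) → E)
    rw [Fin.insertNth_zero']
    refine AffineIndependent.affineIndependent_of_notMem_span (i := 0) ?_ ?_
    · refine (affineIndependent_equiv (finSuccAboveEquiv 0)).1 ?_
      have hcons : (fun z : {z : Fin (k + 1) // z ≠ 0} => (Fin.cons a y : Fin (k + 1) → E) z) ∘
          finSuccAboveEquiv 0 = y := by
        funext j
        change (Fin.cons a y : Fin (k + 1) → E) (Fin.succAbove 0 j) = y j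
        simp
      rwa [hcons]
    · have : ((Fin.cons a y : Fin (k + 1) → E) '' {x | x ≠ 0}) = range y := by
        ext z
        simp only [mem_image, mem_ofPred_eq, mem_range, Fin.exists_fin_succ]
        simp
      rw [this]
      simpa using ha

theorem ae_forall_affineIndependent_succAbove (k : ℕ) (hk : k ≤ Module.finrank ℝ E + 1) :
    ∀ᵐ x ∂Measure.pi fun _ : Fin (k + 1) => stdGaussian E,
      ∀ i : Fin (k + 1), AffineIndependent ℝ fun j => x (i.succAbove j) := by
  rw [ae_all_iff]
  intro i
  have mp := measurePreserving_piFinSuccAbove (fun _ : Fin (k + 1) => stdGaussian E) i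
  have mp2 := measurePreserving_snd.comp mp
  exact mp2.quasiMeasurePreserving.ae (ae_affineIndependent_pi_stdGaussian k hk)

/-- Orthogonal changes of coordinates preserve the law of a family of independent standard
Gaussian vectors. -/
theorem map_pi_stdGaussian_orthogonal {ι : Type*} [Fintype ι] [DecidableEq ι] (Q : Matrix ι ι ℝ)
    (hQ : Q.transpose * Q = 1) :
    (Measure.pi fun _ : ι => stdGaussian E).map (fun x i => ∑ j, Q i j • x j) =
      Measure.pi fun _ : ι => stdGaussian E := by
  have hm : Measurable (fun (x : ι → E) i => ∑ j, Q i j • x j) :=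
    measurable_pi_lambda _ fun i => Finset.measurable_sum _ fun j _ =>
      (measurable_pi_apply j).const_smul _
  have hp : IsProbabilityMeasure ((Measure.pi fun _ : ι => stdGaussian E).map
      (fun x i => ∑ j, Q i j • x j)) := Measure.isProbabilityMeasure_map hm.aemeasurable
  rw [← charFun_eq_pi_iff]
  intro t
  -- `s` is the transpose of `Q` applied to `t`: `Q` moves across the inner product, and the
  -- Gaussian characteristic function sees only the norm.
  set s : PiLp 2 (fun _ : ι => E) := WithLp.toLp 2 fun j => ∑ i, Q i j • t i with hs
  have h1 : charFun (((Measure.pi fun _ : ι => stdGaussian E).map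
      (fun x i => ∑ j, Q i j • x j)).map (WithLp.toLp 2)) t =
      charFun ((Measure.pi fun _ : ι => stdGaussian E).map (WithLp.toLp 2)) s := by
    rw [charFun_apply, charFun_apply, integral_map (by fun_prop) (by fun_prop),
      integral_map hm.aemeasurable (by fun_prop), integral_map (by fun_prop) (by fun_prop)]
    congr 1
    ext x
    congr 3
    simp only [PiLp.inner_apply, hs, sum_inner, inner_sum, real_inner_smul_left,
      real_inner_smul_right]
    exact Finset.sum_comm
  have h2 : ∑ j, ‖s j‖ ^ 2 = ∑ i, ‖t i‖ ^ 2 := by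
    have hQ' : Q * Q.transpose = 1 := mul_eq_one_comm.1 hQ
    have hQ2 : ∀ i k, ∑ j, Q i j * Q k j = if i = k then 1 else 0 := by
      intro i k
      have := congrFun (congrFun hQ' i) k
      simpa [Matrix.mul_apply, Matrix.one_apply] using this
    simp only [← real_inner_self_eq_norm_sq, hs, sum_inner, inner_sum, real_inner_smul_left,
      real_inner_smul_right]
    rw [Finset.sum_comm]
    refine Finset.sum_congr rfl fun i _ => ?_
    rw [Finset.sum_comm]
    simp_rw [← mul_assoc, ← Finset.sum_mul, hQ2]
    simp
  rw [h1, charFun_pi]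
  simp_rw [charFun_stdGaussian, ← Complex.exp_sum]
  congr 1
  rw [← Finset.sum_div, ← Finset.sum_div, Finset.sum_neg_distrib, Finset.sum_neg_distrib]
  exact_mod_cast congrArg (fun r : ℝ => -r / 2) h2

end GaussianFamily

/-! ### The affine dependence as a vector of minors -/

section DependenceVector

variable {d : ℕ}

/-- The matrix whose columns are the homogeneous coordinates `(1, x j)` of the points `x j`. -/
def homMatrix (x : Fin (d + 2) → EuclideanSpace ℝ (Fin d)) :
    Matrix (Fin (d + 1)) (Fin (d + 2)) ℝ :=
  Matrix.of (Fin.cons (fun _ => 1) fun k j => x j k)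

/-- The square matrix obtained by putting the row `v` on top of `homMatrix x`. -/
def borderedMatrix (v : Fin (d + 2) → ℝ) (x : Fin (d + 2) → EuclideanSpace ℝ (Fin d)) :
    Matrix (Fin (d + 2)) (Fin (d + 2)) ℝ :=
  Matrix.of (Fin.cons v (homMatrix x))

@[simp] theorem borderedMatrix_zero (v : Fin (d + 2) → ℝ)
    (x : Fin (d + 2) → EuclideanSpace ℝ (Fin d)) (j : Fin (d + 2)) :
    borderedMatrix v x 0 j = v j := rfl

@[simp] theorem borderedMatrix_one (v : Fin (d + 2) → ℝ)
    (x : Fin (d + 2) → EuclideanSpace ℝ (Fin d)) (j : Fin (d + 2)) :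
    borderedMatrix v x 1 j = 1 := rfl

@[simp] theorem borderedMatrix_succ_succ (v : Fin (d + 2) → ℝ)
    (x : Fin (d + 2) → EuclideanSpace ℝ (Fin d)) (k : Fin d) (j : Fin (d + 2)) :
    borderedMatrix v x k.succ.succ j = x j k := rfl

/-- The vector of signed maximal minors of `homMatrix x`: the coefficients of an affine dependence
between the points `x j`. -/
noncomputable def dependenceVector (x : Fin (d + 2) → EuclideanSpace ℝ (Fin d)) :
    EuclideanSpace ℝ (Fin (d + 2)) :=
  WithLp.toLp 2 fun j => (-1) ^ (j : ℕ) * ((homMatrix x).submatrix id j.succAbove).det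

/-- Laplace expansion along the top row. Taking `v` to be a row of `homMatrix x` gives the affine
relations; a coordinate vector isolates one minor. -/
theorem det_borderedMatrix (v : Fin (d + 2) → ℝ) (x : Fin (d + 2) → EuclideanSpace ℝ (Fin d)) :
    (borderedMatrix v x).det = ∑ j, v j * dependenceVector x j := by
  rw [Matrix.det_succ_row_zero]
  refine Finset.sum_congr rfl fun j _ => ?_
  have : (borderedMatrix v x).submatrix Fin.succ j.succAbove =
      (homMatrix x).submatrix id j.succAbove := rfl
  rw [this, borderedMatrix_zero, dependenceVector]
  ring

theorem sum_dependenceVector (x : Fin (d + 2) → EuclideanSpace ℝ (Fin d)) :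
    ∑ j, dependenceVector x j = 0 := by
  have := det_borderedMatrix (fun _ => 1) x
  rw [Matrix.det_zero_of_row_eq (i := 0) (j := 1) (by simp)] at this
  · simpa using this.symm
  · ext j; simp 

theorem sum_dependenceVector_smul (x : Fin (d + 2) → EuclideanSpace ℝ (Fin d)) :
    ∑ j, dependenceVector x j • x j = 0 := by
  ext k
  have := det_borderedMatrix (fun j => x j k) x
  rw [Matrix.det_zero_of_row_eq (i := 0) (j := k.succ.succ) (Fin.succ_ne_zero _).symm] at this
  · simpa [mul_comm] using this.symm
  · ext j; simp 

theorem eq_zero_of_affine_relation {E : Type*} [AddCommGroup E] [Module ℝ E] {n : ℕ}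
    {x : Fin (n + 1) → E} {i : Fin (n + 1)}
    (hx : AffineIndependent ℝ fun j => x (i.succAbove j)) {w : Fin (n + 1) → ℝ}
    (h0 : ∑ j, w j = 0) (h1 : ∑ j, w j • x j = 0) (hi : w i = 0) : w = 0 := by
  rw [Fin.sum_univ_succAbove _ i, hi] at h0 h1
  rw [zero_add] at h0
  rw [zero_smul, zero_add] at h1
  have := affineIndependent_iff.1 hx Finset.univ (fun j => w (i.succAbove j)) h0 h1
  ext j
  induction j using Fin.succAboveCases i with
  | x => exact hi
  | p j => exact this j (Finset.mem_univ _)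

/-- If the minor vanished, the matrix bordered by the `i`-th unit vector would have a kernel vector:
a nontrivial affine relation not involving `x i`. -/
theorem dependenceVector_apply_ne_zero {x : Fin (d + 2) → EuclideanSpace ℝ (Fin d)}
    {i : Fin (d + 2)} (hx : AffineIndependent ℝ fun j => x (i.succAbove j)) :
    dependenceVector x i ≠ 0 := by
  intro h
  have hdet : (borderedMatrix (Pi.single i 1) x).det = 0 := by
    rw [det_borderedMatrix, Finset.sum_eq_single i]
    · simp [h]
    · intro j _ hj; simp [hj]
    · simp
  obtain ⟨w, hw, hMw⟩ := Matrix.exists_mulVec_eq_zero_iff.2 hdet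
  refine hw (eq_zero_of_affine_relation hx ?_ ?_ ?_)
  · have := congrFun hMw 1
    simpa [Matrix.mulVec, dotProduct] using this
  · ext k
    have := congrFun hMw k.succ.succ
    simpa [Matrix.mulVec, dotProduct, mul_comm] using this
  · have := congrFun hMw 0
    simpa [Matrix.mulVec, dotProduct, Pi.single_apply] using this

theorem affine_relation_eq_smul_dependenceVector {x : Fin (d + 2) → EuclideanSpace ℝ (Fin d)}
    {i : Fin (d + 2)} (hx : AffineIndependent ℝ fun j => x (i.succAbove j)) {w : Fin (d + 2) → ℝ}
    (h0 : ∑ j, w j = 0) (h1 : ∑ j, w j • x j = 0) (j : Fin (d + 2)) :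
    w j = w i / dependenceVector x i * dependenceVector x j := by
  have hi := dependenceVector_apply_ne_zero hx
  set t := w i / dependenceVector x i with ht
  have := eq_zero_of_affine_relation hx (w := fun j => w j - t * dependenceVector x j)
    (by rw [Finset.sum_sub_distrib, ← Finset.mul_sum, h0, sum_dependenceVector]; simp)
    (by simp_rw [sub_smul, mul_smul]
        rw [Finset.sum_sub_distrib, ← Finset.smul_sum, h1, sum_dependenceVector_smul]; simp)
    (by simp [ht, hi])
  exact sub_eq_zero.1 (congrFun this j)

theorem measurable_dependenceVector : Measurable (dependenceVector (d := d)) := by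
  refine Continuous.measurable ?_
  refine (PiLp.continuous_toLp 2 _).comp (continuous_pi fun j => continuous_const.mul ?_)
  refine Continuous.matrix_det (continuous_matrix fun a b => ?_)
  refine Fin.cases ?_ (fun k => ?_) a
  · simpa [homMatrix] using continuous_const
  · simp only [homMatrix, Matrix.submatrix_apply, Matrix.of_apply, id, Fin.cons_succ]
    fun_prop

/-- Under an orthogonal symmetric change of the points which preserves the all-ones vector,
the dependence vector changes accordingly, up to sign. -/
theorem dependenceVector_orthogonal (Q : Matrix (Fin (d + 2)) (Fin (d + 2)) ℝ)
    (hsymm : ∀ i j, Q i j = Q j i) (hQ : Q * Q = 1) (hone : ∀ i, ∑ j, Q i j = 1)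
    (x : Fin (d + 2) → EuclideanSpace ℝ (Fin d)) (i : Fin (d + 2)) :
    dependenceVector (fun i => ∑ j, Q i j • x j) i = Q.det * ∑ j, Q i j * dependenceVector x j := by
  -- Row by row: `Q * Q = 1` turns row `Q i` into the unit vector, symmetry and `hone` fix the row
  -- of ones, and the coordinate rows are mixed by `Q`.
  have key : borderedMatrix (Pi.single i 1) (fun i => ∑ j, Q i j • x j) =
      borderedMatrix (Q i) x * Q := by
    ext a b
    rw [Matrix.mul_apply]
    refine Fin.cases ?_ (fun a => Fin.cases ?_ (fun k => ?_) a) a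
    · have := congrFun (congrFun hQ i) b
      rw [Matrix.mul_apply] at this
      simp [this, Matrix.one_apply, Pi.single_apply, eq_comm]
    · simp [hsymm _ b, hone]
    · simp [hsymm _ b, mul_comm]
  have h := congrArg Matrix.det key
  rw [Matrix.det_mul, det_borderedMatrix, det_borderedMatrix, mul_comm] at h
  rw [← h, Finset.sum_eq_single i]
  · simp
  · intro j _ hj; simp [hj]
  · simp

/-- One row changes sign, hence so does every minor. This yields symmetry of the law under negation,
and is where a coordinate, i.e. `1 ≤ d`, is needed. -/
theorem dependenceVector_flip (k : Fin d) {x y : Fin (d + 2) → EuclideanSpace ℝ (Fin d)}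
    (hxy : ∀ j l, y j l = if l = k then -x j l else x j l) :
    dependenceVector y = -dependenceVector x := by
  ext i
  have key : borderedMatrix (Pi.single i 1) y =
      Matrix.diagonal (fun a => if a = k.succ.succ then -1 else 1) *
        borderedMatrix (Pi.single i 1) x := by
    ext a b
    rw [Matrix.diagonal_mul]
    refine Fin.cases ?_ (fun a => Fin.cases ?_ (fun l => ?_) a) a
    · simp [(Fin.succ_ne_zero _).symm]
    · have h1 : (1 : Fin (d + 2)) ≠ k.succ.succ := fun h =>
        (Fin.succ_ne_zero k).symm (Fin.succ_injective _ h)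
      simp [h1]
    · simp [hxy]
  have h := congrArg Matrix.det key
  rw [Matrix.det_mul, det_borderedMatrix, det_borderedMatrix, Matrix.det_diagonal,
    Finset.prod_ite_eq' ] at h
  have e : ∀ z : Fin (d + 2) → ℝ, ∑ j, (Pi.single i 1 : Fin (d + 2) → ℝ) j * z j = z i := by
    intro z
    simp [Pi.single_apply]
  rw [e, e] at h
  simpa using h

end DependenceVector

/-! ### Simplices and sign patterns of the dependence -/

section Simplex

variable {d : ℕ}

/-- The cone spanned by `e j - e i`, in coordinates. -/
def vertexCone (n : ℕ) (i : Fin n) : Set (EuclideanSpace ℝ (Fin n)) :=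
  {v | ∑ j, v j = 0 ∧ ∀ j ≠ i, 0 ≤ v j}

theorem exists_weights_of_mem_convexHull_range {E ι : Type*} [AddCommGroup E] [Module ℝ E]
    [Fintype ι] {v : ι → E} {y : E} (hy : y ∈ convexHull ℝ (range v)) :
    ∃ w : ι → ℝ, (∀ i, 0 ≤ w i) ∧ ∑ i, w i = 1 ∧ ∑ i, w i • v i = y := by
  classical
  have hconv : Convex ℝ (Fintype.linearCombination ℝ v '' stdSimplex ℝ ι) :=
    (convex_stdSimplex ℝ ι).linear_image _
  obtain ⟨w, hw, rfl⟩ := convexHull_min (t := Fintype.linearCombination ℝ v '' stdSimplex ℝ ι)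
    (by rintro _ ⟨i, rfl⟩
        exact ⟨Pi.single i 1, single_mem_stdSimplex ℝ i, by simp⟩) hconv hy
  exact ⟨w, hw.1, hw.2, rfl⟩

theorem AffineIndependent.mem_extremePoints_convexHull {E ι : Type*} [AddCommGroup E] [Module ℝ E]
    [Fintype ι] {v : ι → E} (hv : AffineIndependent ℝ v) (a : ι) :
    v a ∈ (convexHull ℝ (range v)).extremePoints ℝ := by
  classical
  refine mem_extremePoints.2 ⟨subset_convexHull ℝ _ (mem_range_self a), ?_⟩
  have main : ∀ y ∈ convexHull ℝ (range v), ∀ z ∈ convexHull ℝ (range v),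
      v a ∈ openSegment ℝ y z → y = v a := by
    intro y hy z hz ⟨s, t, hs, ht, hst, h⟩
    obtain ⟨p, hp, hp1, rfl⟩ := exists_weights_of_mem_convexHull_range hy
    obtain ⟨q, hq, hq1, rfl⟩ := exists_weights_of_mem_convexHull_range hz
    have h0 := affineIndependent_iff.1 hv Finset.univ
      (fun b => s * p b + t * q b - (Pi.single a 1 : ι → ℝ) b)
      (by simp [Finset.sum_sub_distrib, Finset.sum_add_distrib, ← Finset.mul_sum, hp1, hq1, hst])
      (by simp only [sub_smul, add_smul, mul_smul, Finset.sum_sub_distrib, Finset.sum_add_distrib,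
            ← Finset.smul_sum, h]
          simp [Pi.single_apply])
    have hpb : ∀ b, b ≠ a → p b = 0 := by
      intro b hb
      have := h0 b (Finset.mem_univ _)
      simp only [Pi.single_eq_of_ne hb, sub_zero] at this
      have h3 := mul_nonneg hs.le (hp b)
      have h4 := mul_nonneg ht.le (hq b)
      have h5 : s * p b = 0 := by linarith
      exact (mul_eq_zero.1 h5).resolve_left hs.ne'
    have hpa : p a = 1 := by
      rw [← hp1, Finset.sum_eq_single a (fun b _ hb => hpb b hb) (by simp)]
    rw [Finset.sum_eq_single a (fun b _ hb => by simp [hpb b hb]) (by simp), hpa, one_smul]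
  exact fun y hy z hz h => ⟨main y hy z hz h, main z hz y hy (openSegment_symm ℝ y z ▸ h)⟩

/-- Here `w i < 0` is the only negative coefficient, so dividing by `-w i` exhibits `x i` as a
convex combination of the other points. -/
theorem isSimplex_of_mem_vertexCone {x : Fin (d + 2) → EuclideanSpace ℝ (Fin d)}
    {i : Fin (d + 2)} (hx : AffineIndependent ℝ fun j => x (i.succAbove j))
    {w : EuclideanSpace ℝ (Fin (d + 2))} (hw : w ∈ vertexCone (d + 2) i) (hi : w i ≠ 0)
    (h1 : ∑ j, w j • x j = 0) : IsSimplex (convexHull ℝ (range x)) := by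
  refine ⟨d, fun j => x (i.succAbove j), hx, ?_⟩
  obtain ⟨h0, hpos⟩ := hw
  rw [Fin.sum_univ_succAbove _ i] at h0 h1
  have hpos' : ∀ j, 0 ≤ w (i.succAbove j) := fun j => hpos _ (Fin.succAbove_ne i j)
  have hneg : 0 < - w i := by
    have := Finset.sum_nonneg fun j (_ : j ∈ Finset.univ) => hpos' j
    exact lt_of_le_of_ne (by linarith) (by simpa [eq_comm] using hi)
  have hmem : x i ∈ convexHull ℝ (range fun j => x (i.succAbove j)) := by
    have hsum : ∑ j, (w (i.succAbove j) / -w i) • x (i.succAbove j) = x i := by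
      have e : ∀ j, (w (i.succAbove j) / -w i) • x (i.succAbove j) =
          (-w i)⁻¹ • w (i.succAbove j) • x (i.succAbove j) := fun j => by
        rw [smul_smul]; congr 1; field_simp
      simp_rw [e]
      rw [← Finset.smul_sum, ← neg_eq_of_add_eq_zero_right h1, ← neg_smul, smul_smul,
        inv_mul_cancel₀ hneg.ne', one_smul]
    rw [← hsum]
    refine (convex_convexHull ℝ _).sum_mem (fun j _ => div_nonneg (hpos' j) hneg.le) ?_
      fun j _ => subset_convexHull ℝ _ (mem_range_self j)
    rw [← Finset.sum_div, div_eq_one_iff_eq hneg.ne']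
    linarith
  refine Subset.antisymm (convexHull_min ?_ (convex_convexHull ℝ _))
    (convexHull_mono (range_comp_subset_range i.succAbove x))
  rintro _ ⟨j, rfl⟩
  induction j using Fin.succAboveCases i with
  | x => exact hmem
  | p j => exact subset_convexHull ℝ _ (mem_range_self j)

/-- A simplex in dimension `d` has at most `d + 1` vertices. They are extreme points of the hull,
hence among the `x j`, so some `x i` is superfluous. -/
theorem exists_mem_convexHull_of_isSimplex {x : Fin (d + 2) → EuclideanSpace ℝ (Fin d)}
    (h : IsSimplex (convexHull ℝ (range x))) :
    ∃ i, x i ∈ convexHull ℝ (range fun j => x (Fin.succAbove i j)) := by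
  obtain ⟨k, v, hv, hconv⟩ := h
  have hcard : k + 1 ≤ d + 1 := by
    simpa using hv.card_le_finrank_succ.trans (Nat.add_le_add_right (Submodule.finrank_le _) 1)
  have hsub : ∀ a, ∃ j, x j = v a := by
    intro a
    change v a ∈ range x
    have := hv.mem_extremePoints_convexHull a
    rw [← hconv] at this
    exact extremePoints_convexHull_subset this
  choose f hf using hsub
  have : ¬ Function.Surjective f := by
    intro hs
    have := Fintype.card_le_of_surjective f hs
    simp at this
    omega
  obtain ⟨i, hi⟩ := not_forall.1 this
  refine ⟨i, convexHull_mono ?_ (hconv ▸ subset_convexHull ℝ _ (mem_range_self i))⟩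
  rintro _ ⟨a, rfl⟩
  obtain ⟨j, hj⟩ := Fin.exists_succAbove_eq (x := f a) (y := i) fun h => hi ⟨a, h⟩
  exact ⟨j, by simp only [hj, hf]⟩

theorem isSimplex_convexHull_iff {x : Fin (d + 2) → EuclideanSpace ℝ (Fin d)}
    (hx : ∀ i : Fin (d + 2), AffineIndependent ℝ fun j => x (i.succAbove j)) :
    IsSimplex (convexHull ℝ (range x)) ↔ ∃ i, dependenceVector x ∈ vertexCone (d + 2) i ∨
      -dependenceVector x ∈ vertexCone (d + 2) i := by
  constructor
  · intro h
    obtain ⟨i, hi⟩ := exists_mem_convexHull_of_isSimplex h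
    obtain ⟨c, hc, hc1, hcx⟩ := exists_weights_of_mem_convexHull_range hi
    have hne := dependenceVector_apply_ne_zero (hx i)
    have hrel := affine_relation_eq_smul_dependenceVector (hx i) (w := i.insertNth (-1) c)
      (by rw [Fin.sum_univ_succAbove _ i]; simp [hc1])
      (by rw [Fin.sum_univ_succAbove _ i]; simp [hcx])
    rw [Fin.insertNth_apply_same] at hrel
    have hc' : ∀ j ≠ i, 0 ≤ -1 / dependenceVector x i * dependenceVector x j := by
      intro j hj
      obtain ⟨l, rfl⟩ := Fin.exists_succAbove_eq hj
      rw [← hrel, Fin.insertNth_apply_succAbove]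
      exact hc l
    refine ⟨i, ?_⟩
    rcases lt_or_gt_of_ne hne with h0 | h0
    · refine Or.inl ⟨sum_dependenceVector x, fun j hj => ?_⟩
      exact nonneg_of_mul_nonneg_right (hc' j hj) (div_pos_of_neg_of_neg (by norm_num) h0)
    · refine Or.inr ⟨by simp [sum_dependenceVector x], fun j hj => ?_⟩
      have := hc' j hj
      rw [neg_div, neg_mul, ← mul_neg] at this
      exact nonneg_of_mul_nonneg_right this (by positivity)
  · rintro ⟨i, hi | hi⟩
    · exact isSimplex_of_mem_vertexCone (hx i) hi (dependenceVector_apply_ne_zero (hx i))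
        (sum_dependenceVector_smul x)
    · refine isSimplex_of_mem_vertexCone (hx i) hi
        (by simpa using dependenceVector_apply_ne_zero (hx i)) ?_
      simp [sum_dependenceVector_smul x]

/-- In two distinct cones all coordinates would be positive, against the zero sum. For opposite
signs, `3 ≤ n` provides `j ≠ i, k`, where `v j` would be both nonnegative and nonpositive. -/
theorem vertexCone_inter_eq {n : ℕ} (hn : 3 ≤ n) {v : EuclideanSpace ℝ (Fin n)}
    (hv : ∀ j, v j ≠ 0) {i k : Fin n} (hi : v ∈ vertexCone n i) :
    (v ∈ vertexCone n k → i = k) ∧ -v ∉ vertexCone n k := by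
  constructor
  · intro hk
    by_contra hik
    have hpos : 0 < ∑ j, v j := by
      refine Finset.sum_pos (fun j _ => lt_of_le_of_ne ?_ (hv j).symm) ⟨i, Finset.mem_univ _⟩
      by_cases h : j = i
      · exact hk.2 j (h ▸ hik)
      · exact hi.2 j h
    exact hpos.ne' hi.1
  · intro hk
    obtain ⟨j, hj⟩ : ∃ j, j ∉ ({i, k} : Finset (Fin n)) := by
      by_contra! h
      have := Finset.card_le_card (fun j _ => h j : Finset.univ ⊆ ({i, k} : Finset (Fin n)))
      have := Finset.card_le_two (a := i) (b := k)
      simp at *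
      omega
    simp only [Finset.mem_insert, Finset.mem_singleton, not_or] at hj
    have h1 := hi.2 j hj.1
    have h2 := hk.2 j hj.2
    simp at h2
    exact hv j (le_antisymm h2 h1)

end Simplex

/-! ### Reflection invariance of the law of the dependence -/

section SumZero

open scoped RealInnerProductSpace

/-- The hyperplane of vectors with vanishing coordinate sum. -/
def sumZero (n : ℕ) : Submodule ℝ (EuclideanSpace ℝ (Fin n)) where
  carrier := {v | ∑ j, v j = 0}
  add_mem' {a b} ha hb := by
    simp only [mem_ofPred_eq] at *
    simp [Finset.sum_add_distrib, ha, hb]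
  zero_mem' := by simp
  smul_mem' c x hx := by
    simp only [mem_ofPred_eq] at *
    simp [← Finset.mul_sum, hx]

theorem mem_sumZero {n : ℕ} {v : EuclideanSpace ℝ (Fin n)} : v ∈ sumZero n ↔ ∑ j, v j = 0 :=
  Iff.rfl

theorem reflection_orthogonal_span_singleton_apply {E : Type*} [NormedAddCommGroup E]
    [InnerProductSpace ℝ E] (w v : E) :
    Submodule.reflection (ℝ ∙ w)ᗮ v = v - (2 * (⟪w, v⟫ / ‖w‖ ^ 2)) • w := by
  rw [Submodule.reflection_orthogonal_apply, Submodule.reflection_singleton_apply]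
  simp only [RCLike.ofReal_real_eq_id, id]
  module

variable {d : ℕ}

/-- The dependence vector as an element of the hyperplane of vectors with vanishing sum. -/
noncomputable def dependence (x : Fin (d + 2) → EuclideanSpace ℝ (Fin d)) : sumZero (d + 2) :=
  ⟨dependenceVector x, sum_dependenceVector x⟩

theorem measurable_dependence : Measurable (dependence (d := d)) :=
  measurable_dependenceVector.subtype_mk

/-- The law of the dependence of independent standard Gaussian points. -/
noncomputable def dependenceLaw (d : ℕ) : Measure (sumZero (d + 2)) :=
  (Measure.pi fun _ : Fin (d + 2) => stdGaussian (EuclideanSpace ℝ (Fin d))).map dependence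

instance : IsProbabilityMeasure (dependenceLaw d) :=
  Measure.isProbabilityMeasure_map measurable_dependence.aemeasurable

theorem dependenceLaw_map_neg (hd : 1 ≤ d) :
    (dependenceLaw d).map (fun v => -v) = dependenceLaw d := by
  let k : Fin d := ⟨0, hd⟩
  set r := Submodule.reflection (ℝ ∙ (EuclideanSpace.single k (1 : ℝ)))ᗮ
  have hr : (stdGaussian (EuclideanSpace ℝ (Fin d))).map r = stdGaussian _ := stdGaussian_map r
  have mp := measurePreserving_pi (fun _ : Fin (d + 2) => stdGaussian (EuclideanSpace ℝ (Fin d)))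
    (fun _ => stdGaussian (EuclideanSpace ℝ (Fin d))) (f := fun _ => r)
    fun _ => ⟨r.continuous.measurable, hr⟩
  unfold dependenceLaw
  rw [Measure.map_map (by fun_prop) measurable_dependence]
  conv_rhs => rw [← mp.map_eq]
  rw [Measure.map_map measurable_dependence mp.measurable]
  congr 1
  ext x : 2
  refine (dependenceVector_flip k fun j l => ?_).symm
  change r (x j) l = _
  rw [reflection_orthogonal_span_singleton_apply]
  by_cases h : l = k
  · subst h; simp [EuclideanSpace.inner_single_left]; ring
  · simp [h]

theorem reflectionInvariant_dependenceLaw (hd : 1 ≤ d) :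
    ReflectionInvariant (dependenceLaw d) := by
  intro w
  set ρ := Submodule.reflection (ℝ ∙ w)ᗮ
  have hρm : Measurable ρ := ρ.continuous.measurable
  -- `Q` below is the Householder matrix of `w`; it fixes the all-ones vector because `w` has zero
  -- sum. For `w = 0` division by zero gives `a = 0` and `Q = 1`, as it should.
  set a : ℝ := 2 / ‖w‖ ^ 2 with ha
  set u : Fin (d + 2) → ℝ := fun i => (w : EuclideanSpace ℝ (Fin (d + 2))) i with hu
  have hu0 : ∑ i, u i = 0 := w.2
  have huu : a * (a * ∑ i, u i * u i) = 2 * a := by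
    have : ∑ i, u i * u i = ‖w‖ ^ 2 := by
      rw [show ‖w‖ = ‖(w : EuclideanSpace ℝ (Fin (d + 2)))‖ from rfl,
        EuclideanSpace.real_norm_sq_eq]
      simp [hu, sq]
    rw [this, ha]
    by_cases h : ‖w‖ ^ 2 = 0
    · rw [h]; simp
    · rw [div_mul_cancel₀ _ h, mul_comm]
  set Q : Matrix (Fin (d + 2)) (Fin (d + 2)) ℝ :=
    Matrix.of fun i j => (if i = j then 1 else 0) - a * (u i * u j) with hQdef
  have hsymm : ∀ i j, Q i j = Q j i := by
    intro i j; simp [hQdef, eq_comm, mul_comm]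
  have hsum : ∀ i (z : Fin (d + 2) → ℝ), ∑ j, Q i j * z j = z i - a * (∑ j, u j * z j) * u i := by
    intro i z
    simp only [hQdef, Matrix.of_apply, sub_mul, Finset.sum_sub_distrib, ite_mul, one_mul, zero_mul,
      Finset.sum_ite_eq, Finset.mem_univ, if_true, Finset.mul_sum, Finset.sum_mul]
    congr 1
    exact Finset.sum_congr rfl fun j _ => by ring
  have hQ : Q * Q = 1 := by
    ext i j
    rw [Matrix.mul_apply, hsum i fun l => Q l j]
    have : ∑ l, u l * Q l j = ∑ l, Q j l * u l :=
      Finset.sum_congr rfl fun l _ => by rw [hsymm, mul_comm]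
    rw [this, hsum, Matrix.one_apply]
    simp only [hQdef, Matrix.of_apply]
    linear_combination u i * u j * huu
  have hone : ∀ i, ∑ j, Q i j = 1 := by
    intro i
    have := hsum i fun _ => 1
    simpa [hu0] using this
  have mpQ := map_pi_stdGaussian_orthogonal (E := EuclideanSpace ℝ (Fin d)) Q
    (by rw [show Q.transpose = Q from Matrix.ext fun i j => hsymm j i, hQ])
  have hTm : Measurable (fun (x : Fin (d + 2) → EuclideanSpace ℝ (Fin d)) i => ∑ j, Q i j • x j) :=
    measurable_pi_lambda _ fun i => Finset.measurable_sum _ fun j _ =>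
      (measurable_pi_apply j).const_smul (Q i j)
  have hdet : Q.det = 1 ∨ Q.det = -1 := by
    have := congrArg Matrix.det hQ
    rw [Matrix.det_mul, Matrix.det_one] at this
    exact mul_self_eq_one_iff.1 this
  have hρ : ∀ x, dependence (fun i => ∑ j, Q i j • x j) = Q.det • ρ (dependence x) := by
    intro x
    ext i
    have h1 := dependenceVector_orthogonal Q hsymm hQ hone x i
    have h2 : ((ρ (dependence x) : sumZero (d + 2)) : EuclideanSpace ℝ (Fin (d + 2))) i =
        ∑ j, Q i j * dependenceVector x j := by
      rw [hsum, reflection_orthogonal_span_singleton_apply]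
      simp only [Submodule.coe_sub, Submodule.coe_smul, PiLp.sub_apply, PiLp.smul_apply,
        smul_eq_mul, Submodule.coe_inner, PiLp.inner_apply]
      simp only [dependence, hu, ha, RCLike.inner_apply, conj_trivial]
      simp_rw [mul_comm (dependenceVector x _)]
      ring
    rw [Submodule.coe_smul, PiLp.smul_apply, h2]
    exact h1
  have hρm' : Measurable fun v => Q.det • ρ v := hρm.const_smul Q.det
  have hmap : (dependenceLaw d).map (fun v => Q.det • ρ v) = dependenceLaw d := by
    unfold dependenceLaw
    rw [Measure.map_map hρm' measurable_dependence]
    conv_rhs => rw [← mpQ]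
    rw [Measure.map_map measurable_dependence hTm]
    congr 1
    ext x : 1
    exact (hρ x).symm
  -- The spurious factor `Q.det = -1` is absorbed by the symmetry of the law under negation.
  rcases hdet with h | h
  · simpa [h] using hmap
  · calc (dependenceLaw d).map ρ
        = ((dependenceLaw d).map fun v => Q.det • ρ v).map fun v => -v := by
          rw [Measure.map_map (by fun_prop) hρm']
          congr 1
          ext v : 1
          simp [h]
      _ = dependenceLaw d := by rw [hmap, dependenceLaw_map_neg hd]

theorem ae_dependenceLaw_ne_zero : ∀ᵐ v : sumZero (d + 2) ∂dependenceLaw d,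
    ∀ j, (v : EuclideanSpace ℝ (Fin (d + 2))) j ≠ 0 := by
  unfold dependenceLaw
  rw [ae_map_iff measurable_dependence.aemeasurable]
  · filter_upwards [ae_forall_affineIndependent_succAbove (E := EuclideanSpace ℝ (Fin d)) (d + 1)
      (by simp)] with x hx j
    exact dependenceVector_apply_ne_zero (hx j)
  · have h : ∀ j : Fin (d + 2), MeasurableSet
        {v : sumZero (d + 2) | (v : EuclideanSpace ℝ (Fin (d + 2))) j = 0} :=
      fun j => measurableSet_eq_fun (by fun_prop) (by fun_prop)
    convert MeasurableSet.iInter fun j => (h j).compl using 1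
    ext v
    simp

end SumZero

/-! ### Solid angles from reflection invariant measures -/

section SolidAngle

variable {E : Type*} [NormedAddCommGroup E] [InnerProductSpace ℝ E]
  [FiniteDimensional ℝ E] [MeasurableSpace E] [BorelSpace E]

/-- Lebesgue measure restricted to the unit ball is itself reflection invariant, so it is
proportional to `μ` on cones; nontriviality of `H` excludes an atom at the origin. -/
theorem ReflectionInvariant.solidAngle_eq {C : Set E} {H : Submodule ℝ E}
    (hspan : Submodule.span ℝ C = H) [Nontrivial H] (hC : MeasurableSet C)
    (hcone : ∀ x : E, ∀ r : ℝ, 0 < r → (r • x ∈ C ↔ x ∈ C)) {μ : Measure H}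
    [IsFiniteMeasure μ] (hμ : ReflectionInvariant μ) (hμ0 : μ {0} = 0) :
    solidAngle C * μ.real univ = μ.real {v : H | (v : E) ∈ C} := by
  subst hspan
  set S := Submodule.span ℝ C
  have hB : {v : S | (v : E) ∈ Metric.closedBall 0 1} = Metric.closedBall (0 : S) 1 := by
    ext v; simp
  have hball : MeasurableSet (Metric.closedBall (0 : S) 1) := Metric.isClosed_closedBall.measurableSet
  set ν : Measure S := (volume : Measure S).restrict (Metric.closedBall 0 1)
  have : IsFiniteMeasure ν := ⟨by simp [ν, measure_closedBall_lt_top]⟩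
  have hν : ReflectionInvariant ν := by
    intro w
    set ρ := Submodule.reflection (ℝ ∙ w)ᗮ
    have mp : MeasurePreserving ρ volume volume := ρ.measurePreserving
    have h := mp.restrict_preimage hball
    have : ρ ⁻¹' Metric.closedBall 0 1 = Metric.closedBall 0 1 := by
      ext v; simp
    rw [this] at h
    exact h.map_eq
  have hν0 : ν {0} = 0 := Measure.absolutelyContinuous_of_le Measure.restrict_le_self (by simp)
  have hCm : MeasurableSet {v : S | (v : E) ∈ C} := hC.preimage measurable_subtype_coe
  have h := hμ.real_cone_eq hν hμ0 hν0 hCm fun x r hr => hcone x r hr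
  have h1 : ν.real univ = (volume : Measure S).real (Metric.closedBall 0 1) := by
    simp [ν]
  have h2 : ν.real {v : S | (v : E) ∈ C} =
      (volume : Measure S).real {v | (v : E) ∈ Metric.closedBall 0 1 ∩ C} := by
    rw [measureReal_restrict_apply hCm]
    congr 1
    ext v
    simp [and_comm]
  have h3 : 0 < (volume : Measure S).real (Metric.closedBall 0 1) :=
    ENNReal.toReal_pos (Metric.measure_closedBall_pos _ _ one_pos).ne' measure_closedBall_lt_top.ne
  rw [solidAngle, hB, ← h2, ← h1, div_mul_eq_mul_div, ← h, mul_div_assoc, div_self (h1 ▸ h3.ne'), mul_one]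

end SolidAngle

/-! ### The tangent cones of the regular simplex -/

section VertexCone

variable {n : ℕ}

theorem sum_smul_single_sub_single_apply (i : Fin n) (c : {j : Fin n // j ≠ i} → ℝ) (k : Fin n) :
    (∑ j, c j • (EuclideanSpace.single (j : Fin n) (1 : ℝ) - EuclideanSpace.single i 1) :
      EuclideanSpace ℝ (Fin n)) k = if h : k = i then -∑ j, c j else c ⟨k, h⟩ := by
  simp only [WithLp.ofLp_sum, Finset.sum_apply, PiLp.smul_apply, PiLp.sub_apply, smul_eq_mul,
    PiLp.single_apply]
  split_ifs with h
  · subst h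
    rw [← Finset.sum_neg_distrib]
    refine Finset.sum_congr rfl fun j _ => ?_
    simp [j.2.symm]
  · rw [Finset.sum_eq_single ⟨k, h⟩]
    · simp
    · intro j _ hj
      have : k ≠ j := fun e => hj (Subtype.ext e.symm)
      simp [this]
    · simp

theorem posHull_single_sub_single (i : Fin n) :
    posHull (fun j : {j : Fin n // j ≠ i} =>
      (EuclideanSpace.single (j : Fin n) (1 : ℝ) - EuclideanSpace.single i 1)) = vertexCone n i := by
  ext v
  have hsum := fun f : Fin n → ℝ => Fintype.sum_eq_add_sum_subtype_ne f i
  have key := sum_smul_single_sub_single_apply i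
  constructor
  · rintro ⟨c, hc, rfl⟩
    refine ⟨?_, fun j hj => ?_⟩
    · rw [hsum, key]
      simp only [key]
      have : ∀ j : {j : Fin n // j ≠ i}, ¬ (j : Fin n) = i := fun j => j.2
      simp [this]
    · rw [key, dif_neg hj]
      exact hc _
  · rintro ⟨h0, hpos⟩
    refine ⟨fun j => v j, fun j => hpos j j.2, ?_⟩
    ext k
    rw [key]
    split_ifs with h
    · subst h
      rw [hsum] at h0
      linarith
    · rfl

theorem span_vertexCone (i : Fin n) : Submodule.span ℝ (vertexCone n i) = sumZero n := by
  refine le_antisymm (Submodule.span_le.2 fun v hv => hv.1) fun v hv => ?_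
  have hmem : ∀ j : Fin n, (EuclideanSpace.single j (1 : ℝ) - EuclideanSpace.single i 1) ∈
      vertexCone n i := by
    intro j
    refine ⟨by simp, fun k hk => ?_⟩
    simp only [PiLp.sub_apply, PiLp.single_apply, hk, if_false, sub_zero]
    split_ifs <;> norm_num
  have : v = ∑ j, v j • (EuclideanSpace.single j (1 : ℝ) - EuclideanSpace.single i 1) := by
    simp_rw [smul_sub]
    rw [Finset.sum_sub_distrib, ← Finset.sum_smul, mem_sumZero.1 hv, zero_smul, sub_zero]
    ext k
    simp [Finset.sum_apply, Pi.single_apply]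
  rw [this]
  exact Submodule.sum_mem _ fun j _ => Submodule.smul_mem _ _ (Submodule.subset_span (hmem j))

theorem measurableSet_vertexCone (i : Fin n) : MeasurableSet (vertexCone n i) := by
  have : vertexCone n i = {v | ∑ j, v j = 0} ∩ ⋂ j, ⋂ _ : j ≠ i, {v | 0 ≤ v j} := by
    ext v; simp [vertexCone]
  rw [this]
  refine (measurableSet_eq_fun (by fun_prop) (by fun_prop)).inter ?_
  exact MeasurableSet.iInter fun j => MeasurableSet.iInter fun _ =>
    measurableSet_le (by fun_prop) (by fun_prop)

theorem smul_mem_vertexCone_iff (i : Fin n) (v : EuclideanSpace ℝ (Fin n)) (r : ℝ) (hr : 0 < r) :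
    r • v ∈ vertexCone n i ↔ v ∈ vertexCone n i := by
  simp [vertexCone, ← Finset.mul_sum, hr, hr.ne']

instance nontrivial_sumZero (d : ℕ) : Nontrivial (sumZero (d + 2)) := by
  refine ⟨⟨EuclideanSpace.single 0 1 - EuclideanSpace.single 1 1, ?_⟩, 0, fun h => ?_⟩
  · simp [mem_sumZero]
  · have := congrArg (fun v : sumZero (d + 2) => (v : EuclideanSpace ℝ (Fin (d + 2))) 0) h
    simp at this

/-- Used twice: with the law of the dependence for the probability, and with the standard Gaussian
for the integral. -/
theorem internalAngle_mul_eq {d : ℕ} (i : Fin (d + 2)) {μ : Measure (sumZero (d + 2))}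
    [IsFiniteMeasure μ] (hμ : ReflectionInvariant μ) (hμ0 : μ {0} = 0) :
    internalAngle (fun j : Fin (d + 2) =>
      (EuclideanSpace.single j (1 : ℝ) : EuclideanSpace ℝ (Fin (d + 2)))) i * μ.real univ =
      μ.real {v | (v : EuclideanSpace ℝ (Fin (d + 2))) ∈ vertexCone (d + 2) i} := by
  rw [internalAngle, posHull_single_sub_single]
  exact hμ.solidAngle_eq (span_vertexCone i) (measurableSet_vertexCone i)
    (fun x r hr => smul_mem_vertexCone_iff i x r hr) hμ0

end VertexCone

/-! ### The probability as twice the angle sum -/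

section Probability

variable {d : ℕ}

theorem dependenceLaw_singleton_zero : dependenceLaw d {0} = 0 := by
  refine measure_mono_null ?_ (ae_iff.1 (ae_dependenceLaw_ne_zero (d := d)))
  rintro _ rfl
  simp

theorem dependenceLaw_vertexCone (hd : 1 ≤ d) (i : Fin (d + 2)) :
    (dependenceLaw d).real {v | (v : EuclideanSpace ℝ (Fin (d + 2))) ∈ vertexCone (d + 2) i} =
      internalAngle (fun j : Fin (d + 2) =>
        (EuclideanSpace.single j (1 : ℝ) : EuclideanSpace ℝ (Fin (d + 2)))) i := by
  rw [← internalAngle_mul_eq i (reflectionInvariant_dependenceLaw hd) dependenceLaw_singleton_zero]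
  simp

theorem dependenceLaw_neg_vertexCone (hd : 1 ≤ d) (i : Fin (d + 2)) :
    (dependenceLaw d).real {v | -(v : EuclideanSpace ℝ (Fin (d + 2))) ∈ vertexCone (d + 2) i} =
      internalAngle (fun j : Fin (d + 2) =>
        (EuclideanSpace.single j (1 : ℝ) : EuclideanSpace ℝ (Fin (d + 2)))) i := by
  rw [← dependenceLaw_vertexCone hd]
  conv_rhs => rw [← dependenceLaw_map_neg hd]
  have hm : MeasurableSet
      {v : sumZero (d + 2) | (v : EuclideanSpace ℝ (Fin (d + 2))) ∈ vertexCone (d + 2) i} :=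
    (measurableSet_vertexCone i).preimage measurable_subtype_coe
  rw [map_measureReal_apply (by fun_prop) hm]
  rfl

theorem dependenceLaw_iUnion_vertexCone (hd : 1 ≤ d) :
    (dependenceLaw d).real {v | ∃ i, (v : EuclideanSpace ℝ (Fin (d + 2))) ∈ vertexCone (d + 2) i ∨
      -(v : EuclideanSpace ℝ (Fin (d + 2))) ∈ vertexCone (d + 2) i} =
      2 * regularSimplexAngleSum (d + 2) := by
  have hm : ∀ i : Fin (d + 2), MeasurableSet
      {v : sumZero (d + 2) | (v : EuclideanSpace ℝ (Fin (d + 2))) ∈ vertexCone (d + 2) i} :=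
    fun i => (measurableSet_vertexCone i).preimage measurable_subtype_coe
  have hm' : ∀ i : Fin (d + 2), MeasurableSet
      {v : sumZero (d + 2) | -(v : EuclideanSpace ℝ (Fin (d + 2))) ∈ vertexCone (d + 2) i} :=
    fun i => (measurableSet_vertexCone i).preimage (measurable_subtype_coe.neg)
  let A : Fin (d + 2) ⊕ Fin (d + 2) → Set (sumZero (d + 2)) := Sum.elim
    (fun i => {v | (v : EuclideanSpace ℝ (Fin (d + 2))) ∈ vertexCone (d + 2) i})
    (fun i => {v | -(v : EuclideanSpace ℝ (Fin (d + 2))) ∈ vertexCone (d + 2) i})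
  have hA : ∀ a, MeasurableSet (A a) := by rintro (i | i); exacts [hm i, hm' i]
  have hU : {v : sumZero (d + 2) | ∃ i,
      (v : EuclideanSpace ℝ (Fin (d + 2))) ∈ vertexCone (d + 2) i ∨
      -(v : EuclideanSpace ℝ (Fin (d + 2))) ∈ vertexCone (d + 2) i} = ⋃ a, A a := by
    ext v; simp [A, exists_or]
  -- The cones meet only where some coordinate vanishes, a null event.
  have hdisj : Pairwise fun a b => AEDisjoint (dependenceLaw d) (A a) (A b) := by
    intro a b hab
    refine measure_mono_null ?_ (ae_iff.1 (ae_dependenceLaw_ne_zero (d := d)))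
    rintro v ⟨ha, hb⟩ hv
    have hv' : ∀ j, (-(v : EuclideanSpace ℝ (Fin (d + 2)))) j ≠ 0 := by
      intro j; simpa using hv j
    rcases a with i | i <;> rcases b with k | k
    · exact hab (congrArg Sum.inl ((vertexCone_inter_eq (by omega) hv ha).1 hb))
    · exact (vertexCone_inter_eq (by omega) hv ha).2 hb
    · exact (vertexCone_inter_eq (by omega) hv hb).2 ha
    · exact hab (congrArg Sum.inr ((vertexCone_inter_eq (by omega) hv' ha).1 hb))
  rw [hU, measureReal_def, measure_iUnion₀ hdisj fun a => (hA a).nullMeasurableSet, tsum_fintype,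
    ENNReal.toReal_sum fun _ _ => measure_ne_top _ _, Fintype.sum_sum_type, regularSimplexAngleSum,
    two_mul]
  congr 1
  · exact Finset.sum_congr rfl fun i _ => dependenceLaw_vertexCone hd i
  · exact Finset.sum_congr rfl fun i _ => dependenceLaw_neg_vertexCone hd i

theorem probability_isSimplex {Ω : Type*} [MeasurableSpace Ω] {P : Measure Ω}
    [IsProbabilityMeasure P] (hd : 1 ≤ d) {X : Fin (d + 2) → Ω → EuclideanSpace ℝ (Fin d)}
    (hX : ∀ i, HasLaw (X i) (stdGaussian (EuclideanSpace ℝ (Fin d))) P) (hindep : iIndepFun X P) :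
    NullMeasurableSet {ω | IsSimplex (convexHull ℝ (range fun i => X i ω))} P ∧
    P.real {ω | IsSimplex (convexHull ℝ (range fun i => X i ω))} =
      2 * regularSimplexAngleSum (d + 2) := by
  set D : Set (sumZero (d + 2)) :=
    {v | ∃ i, (v : EuclideanSpace ℝ (Fin (d + 2))) ∈ vertexCone (d + 2) i ∨
      -(v : EuclideanSpace ℝ (Fin (d + 2))) ∈ vertexCone (d + 2) i} with hD
  have hDm : MeasurableSet D := by
    have : D = ⋃ i, ({v : sumZero (d + 2) |
        (v : EuclideanSpace ℝ (Fin (d + 2))) ∈ vertexCone (d + 2) i} ∪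
        {v | -(v : EuclideanSpace ℝ (Fin (d + 2))) ∈ vertexCone (d + 2) i}) := by
      ext v; simp [hD]
    rw [this]
    exact MeasurableSet.iUnion fun i =>
      ((measurableSet_vertexCone i).preimage measurable_subtype_coe).union
        ((measurableSet_vertexCone i).preimage measurable_subtype_coe.neg)
  have hXm : AEMeasurable (fun ω i => X i ω) P := aemeasurable_pi_lambda _ fun i => (hX i).aemeasurable
  have hlaw : P.map (fun ω i => X i ω) =
      Measure.pi fun _ : Fin (d + 2) => stdGaussian (EuclideanSpace ℝ (Fin d)) := by
    rw [(iIndepFun_iff_map_fun_eq_pi_map fun i => (hX i).aemeasurable).1 hindep]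
    congr 1
    funext i
    exact (hX i).map_eq
  have hdep : AEMeasurable (fun ω => dependence fun i => X i ω) P :=
    measurable_dependence.comp_aemeasurable hXm
  have hdlaw : P.map (fun ω => dependence fun i => X i ω) = dependenceLaw d := by
    rw [dependenceLaw, ← hlaw, AEMeasurable.map_map_of_aemeasurable
      measurable_dependence.aemeasurable hXm]
    rfl
  have hgen : ∀ᵐ ω ∂P, ∀ i : Fin (d + 2), AffineIndependent ℝ fun j => X (i.succAbove j) ω := by
    have := ae_forall_affineIndependent_succAbove (E := EuclideanSpace ℝ (Fin d)) (d + 1) (by simp)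
    rw [← hlaw] at this
    exact ae_of_ae_map hXm this
  have hae : {ω | IsSimplex (convexHull ℝ (range fun i => X i ω))} =ᵐ[P]
      (fun ω => dependence fun i => X i ω) ⁻¹' D := by
    filter_upwards [hgen] with ω hω
    exact propext (isSimplex_convexHull_iff hω)
  refine ⟨(hdep.nullMeasurable hDm).congr hae.symm, ?_⟩
  rw [measureReal_congr hae, ← dependenceLaw_iUnion_vertexCone hd, ← hdlaw, measureReal_def,
    measureReal_def, Measure.map_apply_of_aemeasurable hdep hDm]

end Probability

/-! ### Half-line Gaussian transforms and linearisation -/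

section GaussianIntegrals

theorem setIntegral_exp_mul_gaussianReal (a : ℝ) :
    ∫ y in Ici (0 : ℝ), Real.exp (a * y) ∂gaussianReal 0 1 =
      Real.exp (a ^ 2 / 2) * cdf (gaussianReal 0 1) a := by
  -- Completing the square: `a * y - y ^ 2 / 2 = a ^ 2 / 2 - (a - y) ^ 2 / 2`.
  have h1 : ∀ y, gaussianPDFReal 0 1 y • (Ici (0 : ℝ)).indicator (fun y => Real.exp (a * y)) y =
      Real.exp (a ^ 2 / 2) * (gaussianPDFReal 0 1 (a - y) * (Iic a).indicator 1 (a - y)) := by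
    intro y
    by_cases hy : 0 ≤ y
    · have : a - y ∈ Iic a := by simpa using hy
      rw [indicator_of_mem (mem_Ici.2 hy), indicator_of_mem this]
      simp only [gaussianPDFReal, smul_eq_mul, Pi.one_apply, mul_one]
      rw [mul_left_comm, mul_assoc, ← Real.exp_add, ← Real.exp_add]
      congr 2
      simp
      ring
    · have : a - y ∉ Iic a := by simpa using hy
      rw [indicator_of_notMem (by simpa using hy), indicator_of_notMem this]
      simp
  rw [← integral_indicator measurableSet_Ici, integral_gaussianReal_eq_integral_smul one_ne_zero]
  simp_rw [h1]
  rw [integral_const_mul, integral_sub_left_eq_self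
    (fun y => gaussianPDFReal 0 1 y * (Iic a).indicator 1 y) volume a]
  congr 1
  have := integral_gaussianReal_eq_integral_smul (μ := 0) (v := 1) one_ne_zero
    (f := (Iic a).indicator (1 : ℝ → ℝ))
  simp only [smul_eq_mul] at this
  rw [← this, integral_indicator_one measurableSet_Iic, cdf_eq_real]

/-- Both sides are entire and agree on the real line, so the identity theorem applies. -/
theorem complexMGF_gaussianReal_restrict_Ici (z : ℂ) :
    complexMGF id ((gaussianReal 0 1).restrict (Ici 0)) z =
      Complex.exp (z ^ 2 / 2) * complexPhi z := by
  have hset : integrableExpSet id ((gaussianReal 0 1).restrict (Ici 0)) = univ := by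
    ext t
    simpa [integrableExpSet] using (integrable_exp_mul_gaussianReal (μ := 0) (v := 1) t).restrict
  have hf : AnalyticOnNhd ℂ (complexMGF id ((gaussianReal 0 1).restrict (Ici 0))) univ := by
    have := analyticOnNhd_complexMGF (X := id) (μ := (gaussianReal 0 1).restrict (Ici 0))
    rw [hset, interior_univ] at this
    exact this.mono fun _ _ => mem_univ _
  have hg : AnalyticOnNhd ℂ (fun z => Complex.exp (z ^ 2 / 2) * complexPhi z) univ := by
    rw [Complex.analyticOnNhd_univ_iff_differentiable]
    have := complexPhi_differentiable
    fun_prop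
  refine hf.eqOn_of_preconnected_of_frequently_eq hg isPreconnected_univ (mem_univ (0 : ℂ)) ?_
    (mem_univ z)
  have hreal : ∀ a : ℝ, complexMGF id ((gaussianReal 0 1).restrict (Ici 0)) a =
      Complex.exp ((a : ℂ) ^ 2 / 2) * complexPhi a := by
    intro a
    rw [complexMGF_ofReal, mgf, complexPhi_ofReal]
    simp only [id]
    rw [setIntegral_exp_mul_gaussianReal]
    push_cast
    rfl
  have htend : Filter.Tendsto (fun a : ℝ => (a : ℂ)) (nhdsWithin 0 {0}ᶜ) (nhdsWithin 0 {0}ᶜ) := by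
    refine tendsto_nhdsWithin_iff.2 ⟨?_, ?_⟩
    · exact (Complex.continuous_ofReal.tendsto' 0 0 (by simp)).mono_left nhdsWithin_le_nhds
    · filter_upwards [self_mem_nhdsWithin] with a ha
      simpa using ha
  exact htend.frequently (Filter.Frequently.of_forall hreal)

/-- The characteristic function of the standard Gaussian measure restricted to a half-line. -/
theorem integral_indicator_mul_cexp_gaussianReal (x : ℝ) :
    ∫ y, (Ici (0 : ℝ)).indicator 1 y * Complex.exp (y * x * Complex.I) ∂gaussianReal 0 1 =
      Complex.exp (-(x : ℂ) ^ 2 / 2) * complexPhi (Complex.I * x) := by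
  have h := complexMGF_gaussianReal_restrict_Ici (x * Complex.I)
  rw [mul_pow, Complex.I_sq, mul_neg_one] at h
  rw [mul_comm Complex.I, ← h, complexMGF, ← integral_indicator measurableSet_Ici]
  congr 1
  ext y
  by_cases hy : y ∈ Ici (0 : ℝ)
  · simp only [indicator_of_mem hy, Pi.one_apply, one_mul, id]
    ring_nf
  · simp [indicator_of_notMem hy]

/-- A characteristic function of a measure of mass at most one. The resulting bound on `Φ(I x)` by
`exp (x ^ 2 / 2)` gives absolute convergence. -/
theorem norm_exp_mul_complexPhi_le (x : ℝ) :
    ‖Complex.exp (-(x : ℂ) ^ 2 / 2) * complexPhi (Complex.I * x)‖ ≤ 1 := by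
  rw [← integral_indicator_mul_cexp_gaussianReal]
  refine (norm_integral_le_of_norm_le_const (C := 1) (ae_of_all _ fun y => ?_)).trans (by simp)
  rw [norm_mul, ← Complex.ofReal_mul, Complex.norm_exp_ofReal_mul_I, mul_one]
  by_cases hy : y ∈ Ici (0 : ℝ)
  · simp [indicator_of_mem hy]
  · simp [indicator_of_notMem hy]

/-- Linearisation of the factor `exp (-(∑ c)² / 2)` by an auxiliary Gaussian variable. -/
theorem integral_pi_gaussianReal_mul_exp_neg_sum_sq {ι : Type*} [Fintype ι] {g : ι → ℝ → ℂ}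
    (hg : ∀ j, Measurable (g j)) (hb : ∀ j y, ‖g j y‖ ≤ 1) :
    ∫ c, (∏ j, g j (c j)) * Complex.exp (-((∑ j, c j : ℝ) : ℂ) ^ 2 / 2)
        ∂Measure.pi (fun _ : ι => gaussianReal 0 1) =
      ∫ x : ℝ, ∏ j, ∫ y : ℝ, g j y * Complex.exp (y * x * Complex.I) ∂gaussianReal 0 1
        ∂gaussianReal 0 1 := by
  -- The exponential is the standard Gaussian characteristic function at `∑ j, c j`, which splits
  -- into a product over `j`.
  have h1 : ∀ c : ι → ℝ, (∏ j, g j (c j)) * Complex.exp (-((∑ j, c j : ℝ) : ℂ) ^ 2 / 2) =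
      ∫ x : ℝ, ∏ j, (g j (c j) * Complex.exp (c j * x * Complex.I)) ∂gaussianReal 0 1 := by
    intro c
    have := charFun_gaussianReal (μ := 0) (v := 1) (∑ j, c j)
    rw [charFun_apply_real] at this
    simp_rw [Finset.prod_mul_distrib]
    rw [integral_const_mul]
    congr 1
    rw [show (-((∑ j, c j : ℝ) : ℂ) ^ 2 / 2) = (((∑ j, c j : ℝ) : ℂ) * ((0 : ℝ) : ℂ) * Complex.I -
      (1 : NNReal) * ((∑ j, c j : ℝ) : ℂ) ^ 2 / 2) by push_cast; ring, ← this]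
    congr 1
    ext x
    rw [← Complex.exp_sum]
    push_cast
    rw [Finset.sum_mul, Finset.sum_mul]
  simp_rw [h1]
  rw [integral_integral_swap]
  · congr 1
    ext x
    exact integral_fintype_prod_eq_prod (𝕜 := ℂ) (fun j y => g j y * Complex.exp (y * x * Complex.I))
  · refine Integrable.of_bound (C := 1) ?_ (ae_of_all _ fun p => ?_)
    · refine Measurable.aestronglyMeasurable ?_
      simp only [Function.uncurry_def]
      exact Finset.measurable_prod _ fun j _ =>
        ((hg j).comp ((measurable_pi_apply j).comp measurable_fst)).mul (by fun_prop)
    · simp only [Function.uncurry_def, norm_prod]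
      refine Finset.prod_le_one (fun _ _ => norm_nonneg _) fun j _ => ?_
      rw [norm_mul, ← Complex.ofReal_mul, Complex.norm_exp_ofReal_mul_I, mul_one]
      exact hb j _

end GaussianIntegrals

/-! ### The internal angle as an integral -/

section AngleIntegral

open scoped RealInnerProductSpace

theorem reflectionInvariant_stdGaussian {E : Type*} [NormedAddCommGroup E] [InnerProductSpace ℝ E]
    [FiniteDimensional ℝ E] [MeasurableSpace E] [BorelSpace E] :
    ReflectionInvariant (stdGaussian E) :=
  fun _ => stdGaussian_map _

theorem stdGaussian_singleton_zero {E : Type*} [NormedAddCommGroup E] [InnerProductSpace ℝ E]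
    [FiniteDimensional ℝ E] [MeasurableSpace E] [BorelSpace E] [Nontrivial E] :
    stdGaussian E {0} = 0 := by
  have := stdGaussian_affineSubspace_eq_zero (⊥ : Submodule ℝ E).toAffineSubspace (fun h => by
    obtain ⟨x, hx⟩ := exists_ne (0 : E)
    have hmem : x ∈ (⊥ : Submodule ℝ E).toAffineSubspace := h ▸ AffineSubspace.mem_top ℝ E x
    exact hx (by simpa using hmem))
  exact measure_mono_null (by rintro _ rfl; exact (⊥ : Submodule ℝ E).zero_mem) this

variable {n : ℕ}

/-- The parametrisation of the hyperplane of vectors with vanishing sum by the coordinates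
different from `i`. -/
noncomputable def sumZeroParam (i : Fin n) (c : {j : Fin n // j ≠ i} → ℝ) : sumZero n :=
  ⟨∑ j, c j • (EuclideanSpace.single (j : Fin n) (1 : ℝ) - EuclideanSpace.single i 1),
    Submodule.sum_mem _ fun j _ => Submodule.smul_mem _ _ (by simp [mem_sumZero])⟩

theorem measurable_sumZeroParam (i : Fin n) : Measurable (sumZeroParam i) := by
  refine Measurable.subtype_mk ?_
  fun_prop

theorem sumZeroParam_mem_vertexCone_iff (i : Fin n) (c : {j : Fin n // j ≠ i} → ℝ) :
    (sumZeroParam i c : EuclideanSpace ℝ (Fin n)) ∈ vertexCone n i ↔ ∀ j, 0 ≤ c j := by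
  have key := sum_smul_single_sub_single_apply i c
  constructor
  · intro h j
    have := h.2 j j.2
    rwa [sumZeroParam, key, dif_neg j.2] at this
  · intro h
    refine ⟨(sumZeroParam i c).2, fun j hj => ?_⟩
    rw [sumZeroParam, key, dif_neg hj]
    exact h _

/-- The Gaussian density `exp (-(∑ c)² / 2)` relative to the standard Gaussian measure. -/
noncomputable def tiltedGaussian (ι : Type*) [Fintype ι] : Measure (ι → ℝ) :=
  (Measure.pi fun _ : ι => gaussianReal 0 1).withDensity
    fun c => ENNReal.ofReal (Real.exp (-(∑ j, c j) ^ 2 / 2))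

theorem integral_tiltedGaussian {ι : Type*} [Fintype ι] (f : (ι → ℝ) → ℂ) :
    ∫ c, f c ∂tiltedGaussian ι =
      ∫ c, f c * Complex.exp (-((∑ j, c j : ℝ) : ℂ) ^ 2 / 2)
        ∂Measure.pi (fun _ : ι => gaussianReal 0 1) := by
  rw [tiltedGaussian, integral_withDensity_eq_integral_toReal_smul (by fun_prop)
    (ae_of_all _ fun _ => ENNReal.ofReal_lt_top)]
  congr 1
  ext c
  rw [ENNReal.toReal_ofReal (Real.exp_pos _).le, Complex.real_smul, mul_comm]
  push_cast
  rfl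

instance {ι : Type*} [Fintype ι] : IsFiniteMeasure (tiltedGaussian ι) := by
  refine isFiniteMeasure_withDensity_ofReal (Integrable.of_bound (C := 1) (by fun_prop)
    (ae_of_all _ fun c => ?_)).2
  rw [Real.norm_eq_abs, Real.abs_exp, Real.exp_le_one_iff]
  nlinarith [sq_nonneg (∑ j, c j)]

theorem integral_gaussianPDFReal_translate (hn : 0 < n) (a : ℝ) :
    ∫ x : ℝ, Real.exp (-(n - 1) * (x - a) ^ 2 / 2) * gaussianPDFReal 0 1 (x - a) = (√n)⁻¹ := by
  have hn' : (0 : ℝ) < n := Nat.cast_pos.2 hn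
  rw [integral_sub_right_eq_self (fun x => Real.exp (-(n - 1) * x ^ 2 / 2) * gaussianPDFReal 0 1 x)]
  have : ∀ x : ℝ, Real.exp (-(n - 1) * x ^ 2 / 2) * gaussianPDFReal 0 1 x =
      (√(2 * Real.pi))⁻¹ * Real.exp (-(n / 2 : ℝ) * x ^ 2) := by
    intro x
    simp only [gaussianPDFReal]
    rw [mul_left_comm, ← Real.exp_add]
    congr 2
    · simp
    · simp; ring
  simp_rw [this]
  rw [integral_const_mul, integral_gaussian, ← Real.sqrt_inv, ← Real.sqrt_mul (by positivity),
    ← Real.sqrt_inv]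
  congr 1
  field_simp

/-- The tilt supplies the missing term `(∑ c j) ^ 2` of the squared norm. Comparing characteristic
functions avoids a Jacobian; `(√n)⁻¹` is the total mass. -/
theorem map_sumZeroParam_tiltedGaussian (i : Fin n) :
    (tiltedGaussian {j : Fin n // j ≠ i}).map (sumZeroParam i) =
      (√n).toNNReal⁻¹ • stdGaussian (sumZero n) := by
  have hn : 0 < n := i.pos
  refine Measure.ext_of_charFun (funext fun h => ?_)
  set u : Fin n → ℝ := fun j => (h : EuclideanSpace ℝ (Fin n)) j with hu
  have hu0 : ∑ j, u j = 0 := h.2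
  have hsum := fun f : Fin n → ℝ => Fintype.sum_eq_add_sum_subtype_ne f i
  have hinner : ∀ c, ⟪sumZeroParam i c, h⟫ = ∑ j, c j * (u j - u i) := by
    intro c
    rw [Submodule.coe_inner, sumZeroParam, sum_inner]
    refine Finset.sum_congr rfl fun j _ => ?_
    rw [real_inner_smul_left, inner_sub_left, EuclideanSpace.inner_single_left,
      EuclideanSpace.inner_single_left]
    simp [hu]
  -- The term `x ^ 2`, from the density of the auxiliary variable, is the missing summand `j = i`;
  -- the cross terms vanish because `∑ u j = 0`.
  have hsq : ∀ x : ℝ, ∑ j : {j : Fin n // j ≠ i}, (x + (u j - u i)) ^ 2 + x ^ 2 =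
      n * (x - u i) ^ 2 + ‖h‖ ^ 2 := by
    intro x
    have h1 := hsum fun j => (x + (u j - u i)) ^ 2
    have h2 : ‖h‖ ^ 2 = ∑ j, u j ^ 2 := by
      rw [show ‖h‖ = ‖(h : EuclideanSpace ℝ (Fin n))‖ from rfl, EuclideanSpace.real_norm_sq_eq]
    have h3 : ∀ j, (x + (u j - u i)) ^ 2 = (x - u i) ^ 2 + 2 * (x - u i) * u j + u j ^ 2 :=
      fun j => by ring
    have h4 : ∑ j, (x + (u j - u i)) ^ 2 = n * (x - u i) ^ 2 + ‖h‖ ^ 2 := by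
      simp_rw [h3]
      rw [Finset.sum_add_distrib, Finset.sum_add_distrib, ← Finset.mul_sum, hu0, h2]
      simp
    rw [← h4, h1, sub_self, add_zero, add_comm]
  rw [charFun_apply, integral_map (measurable_sumZeroParam i).aemeasurable (by fun_prop),
    integral_tiltedGaussian]
  have e1 : ∀ c : {j : Fin n // j ≠ i} → ℝ,
      Complex.exp ((⟪sumZeroParam i c, h⟫ : ℝ) * Complex.I) =
        ∏ j, Complex.exp ((c j : ℝ) * ((u j - u i : ℝ) : ℂ) * Complex.I) := by
    intro c
    rw [hinner, ← Complex.exp_sum]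
    push_cast
    rw [Finset.sum_mul]
  simp_rw [e1]
  rw [integral_pi_gaussianReal_mul_exp_neg_sum_sq
    (g := fun (j : {j : Fin n // j ≠ i}) y => Complex.exp ((y : ℝ) * ((u j - u i : ℝ) : ℂ) * Complex.I))
    (fun j => by fun_prop)
    (fun j y => by rw [← Complex.ofReal_mul, Complex.norm_exp_ofReal_mul_I])]
  have e2 : ∀ (x : ℝ) (j : {j : Fin n // j ≠ i}),
      ∫ y : ℝ, Complex.exp ((y : ℝ) * ((u j - u i : ℝ) : ℂ) * Complex.I) *
        Complex.exp (y * x * Complex.I) ∂gaussianReal 0 1 =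
      Complex.exp (((-(x + (u j - u i)) ^ 2 / 2 : ℝ) : ℂ)) := by
    intro x j
    have := charFun_gaussianReal (μ := 0) (v := 1) (x + (u j - u i))
    rw [charFun_apply_real] at this
    have e : ((-(x + (u j - u i)) ^ 2 / 2 : ℝ) : ℂ) = ((x + (u j - u i) : ℝ) : ℂ) * ((0 : ℝ) : ℂ) *
        Complex.I - (1 : NNReal) * ((x + (u j - u i) : ℝ) : ℂ) ^ 2 / 2 := by
      push_cast; ring
    rw [e, ← this]
    congr 1
    ext y
    rw [← Complex.exp_add]
    congr 1
    push_cast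
    ring
  simp_rw [e2, ← Complex.exp_sum, ← Complex.ofReal_sum, ← Complex.ofReal_exp]
  rw [integral_complex_ofReal, integral_gaussianReal_eq_integral_smul one_ne_zero]
  have e3 : ∀ x : ℝ, gaussianPDFReal 0 1 x •
      Real.exp (∑ j : {j : Fin n // j ≠ i}, -(x + (u j - u i)) ^ 2 / 2) =
      Real.exp (-‖h‖ ^ 2 / 2) *
        (Real.exp (-(n - 1) * (x - u i) ^ 2 / 2) * gaussianPDFReal 0 1 (x - u i)) := by
    intro x
    rw [← Finset.sum_div, Finset.sum_neg_distrib, eq_sub_of_add_eq (hsq x)]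
    simp only [gaussianPDFReal, smul_eq_mul]
    rw [mul_left_comm (Real.exp (-(n - 1) * (x - u i) ^ 2 / 2)), mul_left_comm, mul_assoc,
      ← Real.exp_add, ← Real.exp_add, ← Real.exp_add]
    congr 2
    simp
    ring
  simp_rw [e3]
  rw [integral_const_mul, integral_gaussianPDFReal_translate hn, charFun_apply,
    integral_smul_nnreal_measure, ← charFun_apply, charFun_stdGaussian, NNReal.smul_def,
    NNReal.coe_inv, Real.coe_toNNReal _ (Real.sqrt_nonneg _), Complex.real_smul]
  push_cast
  ring

/-- The cone becomes the orthant, whose indicator is a product, so linearisation leaves `d + 1`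
equal half-line transforms; `√(d + 2)` undoes the normalisation. -/
theorem internalAngle_eq_integral_gaussianReal {d : ℕ} (i : Fin (d + 2)) :
    ((internalAngle (fun j : Fin (d + 2) =>
      (EuclideanSpace.single j (1 : ℝ) : EuclideanSpace ℝ (Fin (d + 2)))) i : ℝ) : ℂ) =
      (√((d : ℝ) + 2) : ℝ) * ∫ x : ℝ,
        (Complex.exp (-(x : ℂ) ^ 2 / 2) * complexPhi (Complex.I * x)) ^ (d + 1)
          ∂gaussianReal 0 1 := by
  have h1 := internalAngle_mul_eq i (reflectionInvariant_stdGaussian (E := sumZero (d + 2)))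
    stdGaussian_singleton_zero
  rw [probReal_univ, mul_one] at h1
  have hm : MeasurableSet
      {v : sumZero (d + 2) | (v : EuclideanSpace ℝ (Fin (d + 2))) ∈ vertexCone (d + 2) i} :=
    (measurableSet_vertexCone i).preimage measurable_subtype_coe
  have hs : (0 : ℝ) < √((d : ℝ) + 2) := Real.sqrt_pos.2 (by positivity)
  have h2 := congrArg (fun κ : Measure (sumZero (d + 2)) =>
    κ.real {v | (v : EuclideanSpace ℝ (Fin (d + 2))) ∈ vertexCone (d + 2) i})
    (map_sumZeroParam_tiltedGaussian i)
  simp only [measureReal_nnreal_smul_apply] at h2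
  rw [map_measureReal_apply (measurable_sumZeroParam i) hm, ← h1, NNReal.coe_inv,
    Real.coe_toNNReal _ (Real.sqrt_nonneg _)] at h2
  push_cast at h2
  have h3 : (sumZeroParam i ⁻¹'
      {v | (v : EuclideanSpace ℝ (Fin (d + 2))) ∈ vertexCone (d + 2) i}) =
      {c | ∀ j, 0 ≤ c j} := by
    ext c
    exact sumZeroParam_mem_vertexCone_iff i c
  rw [h3, eq_inv_mul_iff_mul_eq₀ hs.ne'] at h2
  rw [← h2]
  push_cast
  congr 1
  have hS : MeasurableSet {c : {j : Fin (d + 2) // j ≠ i} → ℝ | ∀ j, 0 ≤ c j} := by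
    have : {c : {j : Fin (d + 2) // j ≠ i} → ℝ | ∀ j, 0 ≤ c j} = univ.pi fun _ => Ici 0 := by
      ext c
      simp only [mem_univ_pi, mem_Ici, mem_ofPred_eq]
    rw [this]
    exact MeasurableSet.univ_pi fun _ => measurableSet_Ici
  have h4 : ∀ c : {j : Fin (d + 2) // j ≠ i} → ℝ,
      {c : {j : Fin (d + 2) // j ≠ i} → ℝ | ∀ j, 0 ≤ c j}.indicator (1 : ({j : Fin (d + 2) // j ≠ i} → ℝ) → ℂ) c =
        ∏ j, (Ici (0 : ℝ)).indicator (1 : ℝ → ℂ) (c j) := by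
    intro c
    by_cases hc : ∀ j, 0 ≤ c j
    · rw [indicator_of_mem (by exact hc)]
      simp [indicator_of_mem, hc]
    · rw [indicator_of_notMem (by exact hc)]
      obtain ⟨j, hj⟩ := not_forall.1 hc
      exact (Finset.prod_eq_zero (Finset.mem_univ j)
        (indicator_of_notMem (show c j ∉ Ici (0 : ℝ) from hj) _)).symm
  have h5 : (((tiltedGaussian {j : Fin (d + 2) // j ≠ i}).real {c | ∀ j, 0 ≤ c j} : ℝ) : ℂ) =
      ∫ c, {c : {j : Fin (d + 2) // j ≠ i} → ℝ | ∀ j, 0 ≤ c j}.indicator (1 : ({j : Fin (d + 2) // j ≠ i} → ℝ) → ℂ) c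
        ∂tiltedGaussian {j : Fin (d + 2) // j ≠ i} := by
    rw [integral_indicator hS]
    simp only [Pi.one_apply, integral_const, Complex.real_smul, mul_one, measureReal_restrict_apply,
      MeasurableSet.univ, univ_inter]
  rw [h5, integral_tiltedGaussian]
  simp_rw [h4]
  rw [integral_pi_gaussianReal_mul_exp_neg_sum_sq (g := fun _ => (Ici (0 : ℝ)).indicator 1)
    (fun _ => measurable_one.indicator measurableSet_Ici) (fun _ y => by
      by_cases hy : y ∈ Ici (0 : ℝ)
      · simp [indicator_of_mem hy]
      · simp [indicator_of_notMem hy])]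
  congr 1
  ext x
  rw [Finset.prod_const, integral_indicator_mul_cexp_gaussianReal]
  simp

theorem internalAngle_eq_integral {d : ℕ} (i : Fin (d + 2)) :
    ((internalAngle (fun j : Fin (d + 2) =>
      (EuclideanSpace.single j (1 : ℝ) : EuclideanSpace ℝ (Fin (d + 2)))) i : ℝ) : ℂ) =
      ((√(2 * Real.pi))⁻¹ : ℝ) *
        ∫ x : ℝ, complexPhi (Complex.I * x / (√((d : ℝ) + 2) : ℝ)) ^ (d + 1) *
          (Real.exp (-x ^ 2 / 2) : ℂ) := by
  have hs : (0 : ℝ) < √((d : ℝ) + 2) := Real.sqrt_pos.2 (by positivity)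
  have hs2 : √((d : ℝ) + 2) ^ 2 = d + 2 := Real.sq_sqrt (by positivity)
  -- The `d + 1` factors `exp (-x ^ 2 / 2)` and the Gaussian density merge into one exponential; the
  -- factor `√(d + 2)` is the Jacobian of the rescaling.
  set f : ℝ → ℂ := fun x => complexPhi (Complex.I * x) ^ (d + 1) *
    (Real.exp (-(d + 2) * x ^ 2 / 2) : ℝ) with hf
  have h1 : ∀ x : ℝ, complexPhi (Complex.I * x / (√((d : ℝ) + 2) : ℝ)) ^ (d + 1) *
      (Real.exp (-x ^ 2 / 2) : ℂ) = f (x / √((d : ℝ) + 2)) := by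
    intro x
    simp only [hf]
    rw [div_pow, hs2]
    push_cast
    rw [mul_div_assoc]
    congr 2
    have : (d : ℂ) + 2 ≠ 0 := by exact_mod_cast (by positivity : (d : ℝ) + 2 ≠ 0)
    field_simp
  simp_rw [h1]
  rw [Measure.integral_comp_div, internalAngle_eq_integral_gaussianReal,
    integral_gaussianReal_eq_integral_smul one_ne_zero, abs_of_pos hs, Complex.real_smul]
  have h2 : ∀ x : ℝ, gaussianPDFReal 0 1 x •
      (Complex.exp (-(x : ℂ) ^ 2 / 2) * complexPhi (Complex.I * x)) ^ (d + 1) =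
      ((√(2 * Real.pi))⁻¹ : ℝ) * f x := by
    intro x
    simp only [hf, gaussianPDFReal]
    rw [mul_pow, ← Complex.exp_nat_mul, Complex.real_smul]
    push_cast
    have : Complex.exp (-((d : ℂ) + 2) * x ^ 2 / 2) = Complex.exp (-(x - 0) ^ 2 / (2 * 1)) *
        Complex.exp ((d + 1) * (-(x : ℂ) ^ 2 / 2)) := by
      rw [← Complex.exp_add]; congr 1; ring
    rw [this, mul_one]
    ring
  simp_rw [h2]
  rw [integral_const_mul]
  ring

theorem integrable_complexPhi_pow_mul_exp (d : ℕ) :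
    Integrable (fun x : ℝ => complexPhi (Complex.I * x / (√((d : ℝ) + 2) : ℝ)) ^ (d + 1) *
        (Real.exp (-x ^ 2 / 2) : ℂ)) := by
  have hs2 : √((d : ℝ) + 2) ^ 2 = d + 2 := Real.sq_sqrt (by positivity)
  have hc := complexPhi_differentiable.continuous
  -- With `y = x / √(d + 2)` the exponent is at most `(d + 1) * y ^ 2 / 2 - x ^ 2 / 2 = -x ^ 2 / (2
  -- * (d + 2))`.
  refine (integrable_exp_neg_mul_sq (b := (2 * ((d : ℝ) + 2))⁻¹) (by positivity)).mono'
    (Continuous.aestronglyMeasurable (by fun_prop)) (ae_of_all _ fun x => ?_)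
  set y := x / √((d : ℝ) + 2) with hy
  have h1 : Complex.I * x / (√((d : ℝ) + 2) : ℝ) = Complex.I * y := by
    rw [hy]; push_cast; ring
  have h2 : ‖complexPhi (Complex.I * y)‖ ≤ Real.exp (y ^ 2 / 2) := by
    have := norm_exp_mul_complexPhi_le y
    rw [norm_mul, Complex.norm_exp] at this
    have e : (-(y : ℂ) ^ 2 / 2).re = -(y ^ 2 / 2) := by
      rw [show (-(y : ℂ) ^ 2 / 2) = ((-(y ^ 2 / 2) : ℝ) : ℂ) by push_cast; ring, Complex.ofReal_re]
    rw [e, Real.exp_neg, inv_mul_le_iff₀ (Real.exp_pos _), mul_one] at this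
    exact this
  rw [h1, norm_mul, norm_pow, Complex.norm_real, Real.norm_eq_abs, Real.abs_exp]
  calc ‖complexPhi (Complex.I * y)‖ ^ (d + 1) * Real.exp (-x ^ 2 / 2)
      ≤ Real.exp (y ^ 2 / 2) ^ (d + 1) * Real.exp (-x ^ 2 / 2) := by gcongr
    _ = Real.exp (-(2 * ((d : ℝ) + 2))⁻¹ * x ^ 2) := by
        rw [← Real.exp_nat_mul, ← Real.exp_add, hy, div_pow, hs2]
        congr 1
        push_cast
        field_simp
        ring

end AngleIntegral

theorem theorem1 {Ω : Type*} [MeasurableSpace Ω] (P : Measure Ω) [IsProbabilityMeasure P]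
    (d : ℕ) (hd : 1 ≤ d) (X : Fin (d + 2) → Ω → EuclideanSpace ℝ (Fin d))
    (hX : ∀ i, HasLaw (X i) (stdGaussian (EuclideanSpace ℝ (Fin d))) P)
    (hindep : iIndepFun X P) :
    NullMeasurableSet {ω | IsSimplex (convexHull ℝ (range fun i => X i ω))} P ∧
    P.real {ω | IsSimplex (convexHull ℝ (range fun i => X i ω))} =
      2 * regularSimplexAngleSum (d + 2) ∧
    Integrable (fun x : ℝ =>
      complexPhi (Complex.I * x / (√((d : ℝ) + 2) : ℝ)) ^ (d + 1) *
        (Real.exp (-x ^ 2 / 2) : ℂ)) ∧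
    ((2 * regularSimplexAngleSum (d + 2) : ℝ) : ℂ) =
      ((2 * ((d : ℝ) + 2) / √(2 * Real.pi) : ℝ) : ℂ) *
        ∫ x : ℝ, complexPhi (Complex.I * x / (√((d : ℝ) + 2) : ℝ)) ^ (d + 1) *
          (Real.exp (-x ^ 2 / 2) : ℂ) := by
  obtain ⟨h1, h2⟩ := probability_isSimplex hd hX hindep
  refine ⟨h1, h2, integrable_complexPhi_pow_mul_exp d, ?_⟩
  rw [regularSimplexAngleSum]
  push_cast
  simp_rw [internalAngle_eq_integral]
  rw [Finset.sum_const, Finset.card_univ, Fintype.card_fin, nsmul_eq_mul]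
  push_cast
  ring
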